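/- Let $(W,S)$ be a Coxeter system with identity $e$ and length function $\ell$, and suppose it is doubly laced, i.e. $m(r,r')\le 4$ for all $r,r'\in S$. Let $\le$ be Bruhat order, $[e,w]=\{u\in W: u\le w\}$, and write $x\lhd y$ if $y$ covers $x$. For $J\subseteq S$ let $W_J$ be the subgroup generated by $J$, and let $u=u^J\cdot u_J$ be the unique factorization of $u\in W$ with $u_J\in W_J$ and $u^J$ having no right descent in $J$; let $u={}_Ju\cdot{}^Ju$ be the unique factorization with ${}_Ju\in W_J$ and ${}^Ju$ having no left descent in $J$. Let $w_0(s,t)$ be the maximum of $W_{\{s,t\}}\cap[e,w]$. A matching of $w$ is an involution $M$ of $[e,w]$ such that, for every $u\le w$, $u\lhd M(u)$ or $M(u)\lhd u$. It is special if $M(u)\le M(v)$ whenever $u\lhd v\le w$ and $M(u)\ne v$. Put $\rho_r(u)=ur$ and $\lambda_r(u)=ru$. A right (left) multiplication matching of $w$ is a matching of $w$ that equals $\rho_r$ with $r$ a right descent of $w$ (respectively $\lambda_r$ with $r$ a left descent of $w$) on $[e,w]$. A right system for $w$ is a quadruple $(J,s,t,M_{st})$ such that: (R1) $J\subseteq S$,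 $s\in J$, $t\in S\setminus J$, and $M_{st}$ is a special matching of $w_0(s,t)$ such that $t\le w_0(s,t)$, $M_{st}(e)=s$ and $M_{st}(t)=ts$; (R2) $(u^J)^{\{s,t\}}\cdot M_{st}\big((u^J)_{\{s,t\}}\cdot{}_{\{s\}}(u_J)\big)\cdot{}^{\{s\}}(u_J)\le w$ for all $u\le w$; (R3) if $r\in J$ and $r\le w^J$, then $r$ and $s$ commute; (R4) if $s,t\le (w^J)^{\{s,t\}}$ then $M_{st}=\rho_s$; if $s\le (w^J)^{\{s,t\}}$ and $t\not\le (w^J)^{\{s,t\}}$ then $M_{st}$ commutes with $\lambda_s$; if $s\not\le (w^J)^{\{s,t\}}$ and $t\le (w^J)^{\{s,t\}}$ then $M_{st}$ commutes with $\lambda_t$ (all on $[e,w_0(s,t)]$); (R5) if $v\le w$ and $s\le{}^{\{s\}}(v_J)$, then $M_{st}$ commutes with $\rho_s$ on $[e,v]\cap[e,w_0(s,t)]$. The matching associated with it sends $u\le w$ to the element displayed in (R2). A left system for $w$ is the mirror notion: (L1) $J\subseteq S$, $s\in J$, $t\in S\setminus J$, and $M_{st}$ is a special matching of $w_0(s,t)$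 such that $t\le w_0(s,t)$, $M_{st}(e)=s$ and $M_{st}(t)=st$; (L2) $({}_Ju)^{\{s\}}\cdot M_{st}\big(({}_Ju)_{\{s\}}\cdot{}_{\{s,t\}}({}^Ju)\big)\cdot{}^{\{s,t\}}({}^Ju)\le w$ for all $u\le w$; (L3)–(L5) are obtained from (R3)–(R5) by replacing $w^J$, $(w^J)^{\{s,t\}}$, ${}^{\{s\}}(v_J)$ by ${}^Jw$, ${}^{\{s,t\}}({}^Jw)$, $({}_Jv)^{\{s\}}$ respectively and exchanging $\rho$ and $\lambda$. The matching associated with it sends $u\le w$ to the element displayed in (L2). Let $w\in W$ and let $M$ be a special matching of $w$. (1) If $M$ is associated with a right system $(J,s,t,M_{st})$ for $w$ and is not a right multiplication matching, then there exists a right multiplication matching $\rho$ of $w$ commuting with $M$ such that $\rho(w)\ne M(w)$, unless $m(s,t)=4$, $w_0(s,t)=tst$, $w_J=e$ and $w=(w^J)^{\{s,t\}}\cdot tst$ all hold. (2) If $M$ is associated with a left system $(J,s,t,M_{st})$ for $w$ and is not a left multiplication matching, then there exists a left multiplication matching $\lambda$ of $w$ commuting with $M$ such that $\lambda(w)\ne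 M(w)$, unless $m(s,t)=4$, $w_0(s,t)=tst$, ${}_Jw=e$ and $w=tst\cdot{}^{\{s,t\}}({}^Jw)$ all hold. Here "A unless B" means that A or B holds. -/

import Mathlib

namespace CoxeterSystem

variable {B W : Type*} [Group W] {C : CoxeterMatrix B} (cs : CoxeterSystem C W)

/-- A Coxeter matrix is doubly laced if all its entries are at most `4`
(in Mathlib the entry `0` stands for `∞`, so it is excluded). -/
def _root_.CoxeterMatrix.IsDoublyLaced {B : Type*} (C : CoxeterMatrix B) : Prop :=
  ∀ i j : B, C i j ≠ 0 ∧ C i j ≤ 4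

/-! ### Bruhat order -/

/-- Edges `u → v` of the Bruhat graph: `u⁻¹ v` is a reflection and `ℓ(u) < ℓ(v)`. -/
def BruhatEdge (u v : W) : Prop :=
  cs.IsReflection (u⁻¹ * v) ∧ cs.length u < cs.length v

/-- The Bruhat order: the reflexive and transitive closure of the Bruhat graph. -/
def BruhatLE (u v : W) : Prop :=
  Relation.ReflTransGen cs.BruhatEdge u v

/-- `y` covers `x` in Bruhat order: `x ≠ y` and the interval `[x, y]` is `{x, y}`. -/
def BruhatCovBy (x y : W) : Prop :=
  cs.BruhatLE x y ∧ x ≠ y ∧ ∀ z, cs.BruhatLE x z → cs.BruhatLE z y → z = x ∨ z = y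

/-! ### Parabolic subgroups and parabolic factorizations -/

/-- The parabolic subgroup `W_J` generated by `J`. -/
def parabolic (J : Set B) : Subgroup W :=
  Subgroup.closure (cs.simple '' J)

/-- The set `W^J` of minimal coset representatives: no right descent lies in `J`. -/
def minCosetReps (J : Set B) : Set W :=
  {x | ∀ j ∈ J, ¬ cs.IsRightDescent x j}

theorem exists_parabolic_factorization (J : Set B) (w : W) :
    ∃ p : W × W, p.1 ∈ cs.minCosetReps J ∧ p.2 ∈ cs.parabolic J ∧ w = p.1 * p.2 := by
  induction hn : cs.length w using Nat.strong_induction_on generalizing w with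
  | _ n ih =>
    by_cases h : w ∈ cs.minCosetReps J
    · exact ⟨(w, 1), h, one_mem _, by simp⟩
    · simp only [minCosetReps, Set.mem_ofPred_eq, not_forall, not_not] at h
      obtain ⟨j, hj, hd⟩ := h
      obtain ⟨⟨a, b⟩, ha, hb, hab⟩ := ih _ (hn ▸ hd) (w * cs.simple j) rfl
      refine ⟨(a, b * cs.simple j), ha,
        mul_mem hb (Subgroup.subset_closure (Set.mem_image_of_mem _ hj)), ?_⟩
      simp only at hab ⊢
      rw [← mul_assoc, ← hab, cs.simple_mul_simple_cancel_right]

/-- `cs.upR J w` and `cs.lowR J w` are the factors `w^J ∈ W^J` and `w_J ∈ W_J` of the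
(unique) factorization `w = w^J · w_J`. -/
noncomputable def upR (J : Set B) (w : W) : W :=
  (cs.exists_parabolic_factorization J w).choose.1

/-- The factor `w_J ∈ W_J` of the factorization `w = w^J · w_J`. -/
noncomputable def lowR (J : Set B) (w : W) : W :=
  (cs.exists_parabolic_factorization J w).choose.2

theorem upR_mem (J : Set B) (w : W) : cs.upR J w ∈ cs.minCosetReps J :=
  (cs.exists_parabolic_factorization J w).choose_spec.1

theorem lowR_mem (J : Set B) (w : W) : cs.lowR J w ∈ cs.parabolic J :=
  (cs.exists_parabolic_factorization J w).choose_spec.2.1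

theorem upR_mul_lowR (J : Set B) (w : W) : cs.upR J w * cs.lowR J w = w :=
  (cs.exists_parabolic_factorization J w).choose_spec.2.2.symm

/-- The factor `ᴶw ∈ ᴶW = (W^J)⁻¹` of the (unique) left factorization `w = _Jw · ᴶw`,
obtained by inverting the right factorization of `w⁻¹`. -/
noncomputable def upL (J : Set B) (w : W) : W := (cs.upR J w⁻¹)⁻¹

/-- The factor `_Jw ∈ W_J` of the left factorization `w = _Jw · ᴶw`. -/
noncomputable def lowL (J : Set B) (w : W) : W := (cs.lowR J w⁻¹)⁻¹

theorem not_isLeftDescent_upL (J : Set B) (w : W) :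
    ∀ j ∈ J, ¬ cs.IsLeftDescent (cs.upL J w) j := by
  intro j hj
  rw [upL, cs.isLeftDescent_inv_iff]
  exact cs.upR_mem J w⁻¹ j hj

theorem lowL_mem (J : Set B) (w : W) : cs.lowL J w ∈ cs.parabolic J :=
  inv_mem (cs.lowR_mem J w⁻¹)

theorem lowL_mul_upL (J : Set B) (w : W) : cs.lowL J w * cs.upL J w = w := by
  rw [lowL, upL, ← mul_inv_rev, upR_mul_lowR, inv_inv]

/-- `x` is the greatest element of `W_J ∩ [e, w]`. -/
def IsParabolicMax (J : Set B) (w x : W) : Prop :=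
  (x ∈ cs.parabolic J ∧ cs.BruhatLE x w) ∧
    ∀ y ∈ cs.parabolic J, cs.BruhatLE y w → cs.BruhatLE y x

open Classical in
/-- `w₀(J)`: the maximum of `W_J ∩ [e, w]`. It always exists; the value `1` in the other branch
is only a placeholder. -/
noncomputable def parabolicMax (J : Set B) (w : W) : W :=
  if h : ∃ x, cs.IsParabolicMax J w x then h.choose else 1

/-! ### Special matchings

Maps on a lower interval `[e, w]` are represented by functions `W → W`, whose values outside
`[e, w]` play no role. -/

/-- `M` is a matching of `w`: an involution of `[e, w]` such that every `{u, M u}` is an edge of the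
Hasse diagram. -/
structure IsMatching (w : W) (M : W → W) : Prop where
  mapsTo : ∀ u, cs.BruhatLE u w → cs.BruhatLE (M u) w
  involutive : ∀ u, cs.BruhatLE u w → M (M u) = u
  edge : ∀ u, cs.BruhatLE u w → cs.BruhatCovBy u (M u) ∨ cs.BruhatCovBy (M u) u

/-- `M` is a special matching of `w`. -/
structure IsSpecialMatching (w : W) (M : W → W) : Prop extends cs.IsMatching w M where
  special : ∀ u v, cs.BruhatLE u w → cs.BruhatLE v w → cs.BruhatCovBy u v → M u ≠ v →
    cs.BruhatLE (M u) (M v)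

/-- Two maps commute on `[e, w]`. -/
def CommuteOn (w : W) (M N : W → W) : Prop :=
  ∀ u, cs.BruhatLE u w → M (N u) = N (M u)

/-- The map `ρ_i : u ↦ u s_i`. -/
def rho (i : B) (u : W) : W := u * cs.simple i

/-- The map `λ_i : u ↦ s_i u`. -/
def lam (i : B) (u : W) : W := cs.simple i * u

/-- `M` is a right multiplication matching of `w`: a matching of `w` which agrees on `[e, w]`
with `ρ_i` for some right descent `i` of `w`. -/
def IsRightMulMatching (w : W) (M : W → W) : Prop :=
  cs.IsMatching w M ∧
    ∃ i : B, cs.IsRightDescent w i ∧ ∀ u, cs.BruhatLE u w → M u = cs.rho i u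

/-- `M` is a left multiplication matching of `w`: a matching of `w` which agrees on `[e, w]`
with `λ_i` for some left descent `i` of `w`. -/
def IsLeftMulMatching (w : W) (M : W → W) : Prop :=
  cs.IsMatching w M ∧
    ∃ i : B, cs.IsLeftDescent w i ∧ ∀ u, cs.BruhatLE u w → M u = cs.lam i u

/-! ### Right and left systems -/

/-- `u ↦ (u^J)^{s,t} · N((u^J)_{s,t} · _{s}(u_J)) · ^{s}(u_J)`. -/
noncomputable def rightSystemMap (J : Set B) (s t : B) (N : W → W) (u : W) : W :=
  cs.upR {s, t} (cs.upR J u) *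
    N (cs.lowR {s, t} (cs.upR J u) * cs.lowL {s} (cs.lowR J u)) *
    cs.upL {s} (cs.lowR J u)

/-- `u ↦ (_Ju)^{s} · N((_Ju)_{s} · _{s,t}(^Ju)) · ^{s,t}(^Ju)`. -/
noncomputable def leftSystemMap (J : Set B) (s t : B) (N : W → W) (u : W) : W :=
  cs.upR {s} (cs.lowL J u) *
    N (cs.lowR {s} (cs.lowL J u) * cs.lowL {s, t} (cs.upL J u)) *
    cs.upL {s, t} (cs.upL J u)

/-- `(J, s, t, N)` is a right system for `w`. -/
structure IsRightSystem (w : W) (J : Set B) (s t : B) (N : W → W) : Prop where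
  s_mem : s ∈ J
  t_notMem : t ∉ J
  special : cs.IsSpecialMatching (cs.parabolicMax {s, t} w) N
  map_one : N 1 = cs.simple s
  /-- `t` lies in the domain of `N`. -/
  t_le : cs.BruhatLE (cs.simple t) (cs.parabolicMax {s, t} w)
  map_t : N (cs.simple t) = cs.simple t * cs.simple s
  map_le : ∀ u, cs.BruhatLE u w → cs.BruhatLE (cs.rightSystemMap J s t N u) w
  commute_s : ∀ r ∈ J, cs.BruhatLE (cs.simple r) (cs.upR J w) →
    cs.simple r * cs.simple s = cs.simple s * cs.simple r
  both_le : cs.BruhatLE (cs.simple s) (cs.upR {s, t} (cs.upR J w)) →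
    cs.BruhatLE (cs.simple t) (cs.upR {s, t} (cs.upR J w)) →
    ∀ x, cs.BruhatLE x (cs.parabolicMax {s, t} w) → N x = cs.rho s x
  only_s_le : cs.BruhatLE (cs.simple s) (cs.upR {s, t} (cs.upR J w)) →
    ¬ cs.BruhatLE (cs.simple t) (cs.upR {s, t} (cs.upR J w)) →
    cs.CommuteOn (cs.parabolicMax {s, t} w) N (cs.lam s)
  only_t_le : ¬ cs.BruhatLE (cs.simple s) (cs.upR {s, t} (cs.upR J w)) →
    cs.BruhatLE (cs.simple t) (cs.upR {s, t} (cs.upR J w)) →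
    cs.CommuteOn (cs.parabolicMax {s, t} w) N (cs.lam t)
  commute_rho : ∀ v, cs.BruhatLE v w →
    cs.BruhatLE (cs.simple s) (cs.upL {s} (cs.lowR J v)) →
    ∀ x, cs.BruhatLE x v → cs.BruhatLE x (cs.parabolicMax {s, t} w) →
      N (cs.rho s x) = cs.rho s (N x)

/-- `(J, s, t, N)` is a left system for `w`. -/
structure IsLeftSystem (w : W) (J : Set B) (s t : B) (N : W → W) : Prop where
  s_mem : s ∈ J
  t_notMem : t ∉ J
  special : cs.IsSpecialMatching (cs.parabolicMax {s, t} w) N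
  map_one : N 1 = cs.simple s
  /-- `t` lies in the domain of `N`. -/
  t_le : cs.BruhatLE (cs.simple t) (cs.parabolicMax {s, t} w)
  map_t : N (cs.simple t) = cs.simple s * cs.simple t
  map_le : ∀ u, cs.BruhatLE u w → cs.BruhatLE (cs.leftSystemMap J s t N u) w
  commute_s : ∀ r ∈ J, cs.BruhatLE (cs.simple r) (cs.upL J w) →
    cs.simple r * cs.simple s = cs.simple s * cs.simple r
  both_le : cs.BruhatLE (cs.simple s) (cs.upL {s, t} (cs.upL J w)) →
    cs.BruhatLE (cs.simple t) (cs.upL {s, t} (cs.upL J w)) →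
    ∀ x, cs.BruhatLE x (cs.parabolicMax {s, t} w) → N x = cs.lam s x
  only_s_le : cs.BruhatLE (cs.simple s) (cs.upL {s, t} (cs.upL J w)) →
    ¬ cs.BruhatLE (cs.simple t) (cs.upL {s, t} (cs.upL J w)) →
    cs.CommuteOn (cs.parabolicMax {s, t} w) N (cs.rho s)
  only_t_le : ¬ cs.BruhatLE (cs.simple s) (cs.upL {s, t} (cs.upL J w)) →
    cs.BruhatLE (cs.simple t) (cs.upL {s, t} (cs.upL J w)) →
    cs.CommuteOn (cs.parabolicMax {s, t} w) N (cs.rho t)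
  commute_lam : ∀ v, cs.BruhatLE v w →
    cs.BruhatLE (cs.simple s) (cs.upR {s} (cs.lowL J v)) →
    ∀ x, cs.BruhatLE x v → cs.BruhatLE x (cs.parabolicMax {s, t} w) →
      N (cs.lam s x) = cs.lam s (N x)

end CoxeterSystem

/-! Split each `u ≤ w` as `u = a * z * d`, where `a = (u^J)^{s,t}`, `z = midR J s t u` lies in
`W_{s,t}`, and `d = ^{s}(u_J)`. The matching `M` of a right system replaces `z` by `N z`. Let `r ∈
J` be a right descent of `w`. Passing from `u` to `ur` only changes `u_J`: either `d * r` is the new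
third factor, or `d * r = s * d` and `z` becomes `z * s`. So `M` commutes with `ρ_r` once `N`
commutes with `ρ_s` at the `z` of the second kind (`IsRightSystem.commuteOn_rho`).

Suppose the third factor `d` of `w` is nontrivial, and take for `r` a right descent of `d` in `J`.
Condition (R5) supplies the commutation. If `wr = M w`, then `d r d⁻¹` would lie in `W_J ∩ W_{s,t} =
W_{s}`, which is incompatible with lengths (`IsRightSystem.exists_of_upL_ne_one`).

Suppose `d = 1`. If `N = ρ_s`, then (R3) gives `M = ρ_s` (`IsRightSystem.rightSystemMap_eq_rho`), a
right multiplication matching. Otherwise, inspection of the dihedral groups of orders 4, 6, 8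
(`IsMatching.dihedral`) leaves `m(s,t) = 4`, `N(st) = tst`, and `w₀(s,t)` equal to `tst` or `stst`.
Now (R4) forbids `s ≤ a`, and together with `M w ≤ w` this forces `z = w₀(s,t)`. The value `tst` is
the exceptional case; for `stst`, `N` commutes with `ρ_s`, and `ρ_s` is the required matching.

Left systems become right systems under inversion. The groundwork is strong exchange, obtained from
a signed conjugation action, then the lifting property of Bruhat order, uniqueness of parabolic
factorizations, and distinctness of the simple reflections. -/

namespace CoxeterSystem

variable {B W : Type*} [Group W] {C : CoxeterMatrix B} (cs : CoxeterSystem C W)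

/-! ### The strong exchange property -/

open Classical in
/-- The involution `(x, ε) ↦ (sᵢ x sᵢ, ε + [x = sᵢ])`. -/
noncomputable def signedConj (i : B) : Function.End (W × ZMod 2) := fun p =>
  (cs.simple i * p.1 * cs.simple i, p.2 + if p.1 = cs.simple i then 1 else 0)

theorem simple_mul_pow_eq (i j : B) (k : ℕ) :
    ((cs.simple i * cs.simple j) ^ k)⁻¹ * cs.simple j =
      cs.simple j * (cs.simple i * cs.simple j) ^ k := by
  have h : SemiconjBy (cs.simple j) (cs.simple i * cs.simple j) (cs.simple i * cs.simple j)⁻¹ := by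
    simp [SemiconjBy, mul_assoc]
  rw [(h.pow_right k).eq, inv_pow]

theorem _root_.Function.End.mul_apply_eq {α : Type*} (f g : Function.End α) (x : α) :
    (f * g) x = f (g x) := rfl

-- Each of the `2 * n` generators applied flips the sign for exactly one `x`; pulled back through
-- the earlier conjugations, these are the elements `sⱼ (sᵢ sⱼ) ^ l`.
open Classical in
theorem signedConj_mul_pow (i j : B) (n : ℕ) (x : W) (ε : ZMod 2) :
    ((cs.signedConj i * cs.signedConj j) ^ n) (x, ε) =
      ((cs.simple i * cs.simple j) ^ n * x * ((cs.simple i * cs.simple j) ^ n)⁻¹,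
        ε + ∑ l ∈ Finset.range (2 * n),
          if x = cs.simple j * (cs.simple i * cs.simple j) ^ l then 1 else 0) := by
  induction n with
  | zero => simp; rfl
  | succ n ih =>
    rw [pow_succ', Function.End.mul_apply_eq, ih, mul_add, mul_one,
      Finset.sum_range_succ, Finset.sum_range_succ, Function.End.mul_apply_eq]
    set c := cs.simple i * cs.simple j with hc
    have h1 : c ^ n * x * (c ^ n)⁻¹ = cs.simple j ↔ x = cs.simple j * c ^ (2 * n) := by
      rw [two_mul, pow_add, ← mul_assoc, ← cs.simple_mul_pow_eq i j, mul_inv_eq_iff_eq_mul,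
        mul_assoc (c ^ n)⁻¹, eq_inv_mul_iff_mul_eq]
    have h2 : cs.simple j * (c ^ n * x * (c ^ n)⁻¹) * cs.simple j = cs.simple i ↔
        x = cs.simple j * c ^ (2 * n + 1) := by
      have (y : W) : cs.simple j * y * cs.simple j = cs.simple i ↔ y = cs.simple j * c := by
        rw [hc]
        constructor
        · intro h; rw [← h]; simp [mul_assoc]
        · intro h; rw [h]; simp [mul_assoc]
      rw [this, mul_inv_eq_iff_eq_mul, ← eq_inv_mul_iff_mul_eq, mul_assoc, ← mul_assoc (_⁻¹),
        cs.simple_mul_pow_eq i j, mul_assoc, two_mul, pow_add, pow_add, pow_one]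
      rw [← pow_succ', ← pow_add, ← hc, ← pow_add, ← pow_succ, add_assoc]
    simp only [signedConj, h1, h2, add_assoc]
    refine Prod.ext ?_ rfl
    simp [hc, pow_succ', mul_assoc]

theorem isLiftable_signedConj : C.IsLiftable cs.signedConj := by
  classical
  intro i j
  funext ⟨x, ε⟩
  -- Since `(sᵢ sⱼ) ^ m = 1`, the two halves of the sum agree, so it vanishes modulo 2.
  rw [signedConj_mul_pow, two_mul, Finset.sum_range_add]
  simp only [pow_add, cs.simple_mul_simple_pow, one_mul]
  rw [← two_mul, (by decide : (2 : ZMod 2) = 0)]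
  simp; rfl

/-- The action of `W` on `W × {±1}` by signed conjugation. -/
noncomputable def signedConjHom : W →* Function.End (W × ZMod 2) :=
  cs.lift ⟨cs.signedConj, cs.isLiftable_signedConj⟩

theorem signedConjHom_simple (i : B) : cs.signedConjHom (cs.simple i) = cs.signedConj i :=
  cs.lift_apply_simple _ _

open Classical in
theorem signedConjHom_wordProd (ω : List B) (x : W) (ε : ZMod 2) :
    cs.signedConjHom (cs.wordProd ω) (x, ε) =
      (cs.wordProd ω * x * (cs.wordProd ω)⁻¹, ε + ((cs.rightInvSeq ω).count x : ℕ)) := by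
  induction ω with
  | nil => simp; rfl
  | cons i ω ih =>
    rw [wordProd_cons, map_mul, Function.End.mul_apply_eq, ih, signedConjHom_simple,
      rightInvSeq, List.count_cons]
    have : cs.wordProd ω * x * (cs.wordProd ω)⁻¹ = cs.simple i ↔
        (cs.wordProd ω)⁻¹ * cs.simple i * cs.wordProd ω = x := by
      constructor <;> intro h <;> rw [← h] <;> group
    refine Prod.ext (by simp [signedConj, mul_assoc]) ?_
    simp [signedConj, this, add_assoc]

/-- The sign `n(w, x)`, the parity of the multiplicity of `x` in the right inversion sequence
of any word for `w`. -/
noncomputable def invSign (w x : W) : ZMod 2 := (cs.signedConjHom w (x, 0)).2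

open Classical in
theorem invSign_wordProd (ω : List B) (x : W) :
    cs.invSign (cs.wordProd ω) x = ((cs.rightInvSeq ω).count x : ℕ) := by
  rw [invSign, signedConjHom_wordProd]; simp

theorem signedConjHom_apply (w x : W) (ε : ZMod 2) :
    cs.signedConjHom w (x, ε) = (w * x * w⁻¹, ε + cs.invSign w x) := by
  classical
  obtain ⟨ω, rfl⟩ := cs.wordProd_surjective w
  rw [signedConjHom_wordProd, invSign_wordProd]

theorem invSign_mul (u v x : W) :
    cs.invSign (u * v) x = cs.invSign v x + cs.invSign u (v * x * v⁻¹) := by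
  rw [invSign, map_mul, Function.End.mul_apply_eq, signedConjHom_apply,
    signedConjHom_apply]
  simp

theorem invSign_one (x : W) : cs.invSign 1 x = 0 := by
  rw [invSign, map_one]; rfl

/-- For `t = u sᵢ u⁻¹` the cocycle rule `invSign_mul` gives contributions from `u⁻¹`, `sᵢ` and `u`;
the outer two cancel because `u * u⁻¹ = 1`. -/
theorem IsReflection.invSign_self {t : W} (ht : cs.IsReflection t) : cs.invSign t t = 1 := by
  obtain ⟨u, i, rfl⟩ := ht
  have h1 := cs.invSign_mul u u⁻¹ (u * cs.simple i * u⁻¹)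
  have h2 : cs.invSign (cs.simple i) (cs.simple i) = 1 := by
    rw [invSign, signedConjHom_simple]; simp [signedConj]
  have h3 : u⁻¹ * (u * cs.simple i * u⁻¹) * u⁻¹⁻¹ = cs.simple i := by group
  rw [mul_inv_cancel, invSign_one, h3] at h1
  rw [invSign_mul, h3, invSign_mul, mul_inv_cancel_right, h2, add_left_comm, ← h1, add_zero]

/-- The strong exchange property. -/
theorem IsRightInversion.mem_rightInvSeq {ω : List B} {t : W}
    (h : cs.IsRightInversion (cs.wordProd ω) t) : t ∈ cs.rightInvSeq ω := by
  classical
  by_contra hmem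
  have h0 : cs.invSign (cs.wordProd ω) t = 0 := by
    rw [invSign_wordProd, List.count_eq_zero_of_not_mem hmem]; simp
  -- Multiplying by `t` flips the sign at `t`, so a reduced word of the longer element would have
  -- `t` as an inversion, contradicting the lengths.
  have h1 : cs.invSign (cs.wordProd ω * t) t = 1 := by
    rw [invSign_mul, h.1.invSign_self, mul_inv_cancel_right, h0, add_zero]
  obtain ⟨ω', hω', he⟩ := cs.exists_isReduced (cs.wordProd ω * t)
  have h2 : t ∈ cs.rightInvSeq ω' := by
    by_contra hmem'
    rw [he, invSign_wordProd, List.count_eq_zero_of_not_mem hmem'] at h1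
    simp at h1
  have h3 := (cs.isRightInversion_of_mem_rightInvSeq hω' h2).2
  rw [← he, mul_assoc, h.1.mul_self, mul_one] at h3
  exact absurd h.2 (by lia)

theorem IsRightInversion.exists_eraseIdx {ω : List B} {t : W}
    (h : cs.IsRightInversion (cs.wordProd ω) t) :
    ∃ j < ω.length, cs.wordProd ω * t = cs.wordProd (ω.eraseIdx j) := by
  obtain ⟨j, hj, rfl⟩ := List.mem_iff_getElem.mp h.mem_rightInvSeq
  refine ⟨j, by simpa using hj, ?_⟩
  rw [← List.getD_eq_getElem _ 1 hj, wordProd_mul_getD_rightInvSeq]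

end CoxeterSystem

namespace CoxeterSystem

variable {B W : Type*} [Group W] {C : CoxeterMatrix B} (cs : CoxeterSystem C W)

/-! ### Basic properties of the Bruhat order -/

variable {cs}

theorem BruhatLE.refl (u : W) : cs.BruhatLE u u := Relation.ReflTransGen.refl

theorem BruhatLE.trans {u v w : W} (h : cs.BruhatLE u v) (h' : cs.BruhatLE v w) :
    cs.BruhatLE u w := Relation.ReflTransGen.trans h h'

theorem BruhatEdge.le {u v : W} (h : cs.BruhatEdge u v) : cs.BruhatLE u v :=
  Relation.ReflTransGen.single h

theorem BruhatLE.length_le {u v : W} (h : cs.BruhatLE u v) : cs.length u ≤ cs.length v := by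
  induction h with
  | refl => exact le_rfl
  | tail _ h ih => exact ih.trans h.2.le

theorem BruhatLE.eq_of_length_le {u v : W} (h : cs.BruhatLE u v)
    (hl : cs.length v ≤ cs.length u) : u = v := by
  cases h with
  | refl => rfl
  | tail h h' => exact absurd (BruhatLE.length_le h) (by have := h'.2; lia)

theorem BruhatLE.antisymm {u v : W} (h : cs.BruhatLE u v) (h' : cs.BruhatLE v u) : u = v :=
  h.eq_of_length_le h'.length_le

theorem BruhatEdge.inv {u v : W} (h : cs.BruhatEdge u v) : cs.BruhatEdge u⁻¹ v⁻¹ := by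
  refine ⟨?_, by simpa using h.2⟩
  have := (h.1.conj u).isReflection_inv
  convert this using 1
  group

theorem BruhatLE.inv {u v : W} (h : cs.BruhatLE u v) : cs.BruhatLE u⁻¹ v⁻¹ := by
  induction h with
  | refl => exact .refl _
  | tail _ h ih => exact ih.trans h.inv.le

variable (cs) in
theorem bruhatLE_inv_iff {u v : W} : cs.BruhatLE u⁻¹ v⁻¹ ↔ cs.BruhatLE u v :=
  ⟨fun h => by simpa using h.inv, fun h => h.inv⟩

variable (cs) in
theorem bruhatEdge_mul_simple {u : W} {i : B} (h : cs.length u < cs.length (u * cs.simple i)) :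
    cs.BruhatEdge u (u * cs.simple i) :=
  ⟨by simpa using cs.isReflection_simple i, h⟩

variable (cs) in
theorem bruhatEdge_simple_mul {u : W} {i : B} (h : cs.length u < cs.length (cs.simple i * u)) :
    cs.BruhatEdge u (cs.simple i * u) :=
  ⟨by simpa [mul_assoc] using (cs.isReflection_simple i).conj u⁻¹, h⟩

/-- If the edge is not preserved, then `vs` is shorter than `us`. Strong exchange on a reduced word
of `vs` followed by `i` deletes one letter to produce `u`. Deleting from the `vs` part would make
`us` shorter than `vs`, so the last letter goes and `u = vs`. -/
theorem BruhatEdge.mul_simple {u v : W} (h : cs.BruhatEdge u v) (i : B) :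
    u * cs.simple i = v ∨ cs.BruhatEdge (u * cs.simple i) (v * cs.simple i) := by
  obtain ⟨hr, hl⟩ := h
  set t := u⁻¹ * v with ht
  have hr' : cs.IsReflection ((u * cs.simple i)⁻¹ * (v * cs.simple i)) := by
    convert hr.conj (cs.simple i) using 1
    simp [ht, mul_assoc]
  have huv : v * t = u := by
    rw [← hr.inv, ht]; group
  by_cases hlt : cs.length (u * cs.simple i) < cs.length (v * cs.simple i)
  · exact .inr ⟨hr', hlt⟩
  left
  have hne : cs.length (u * cs.simple i) ≠ cs.length (v * cs.simple i) := by
    have := hr'.length_mul_left_ne (u * cs.simple i)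
    rwa [mul_inv_cancel_left, ne_comm] at this
  have h1 := cs.length_mul_simple u i
  have h2 := cs.length_mul_simple v i
  obtain ⟨ω, hω, he⟩ := cs.exists_isReduced (v * cs.simple i)
  have hv : v = cs.wordProd (ω ++ [i]) := by
    rw [wordProd_append, wordProd_singleton, ← he, simple_mul_simple_cancel_right]
  have hinv : cs.IsRightInversion (cs.wordProd (ω ++ [i])) t := by
    rw [← hv]; exact ⟨hr, by rwa [huv]⟩
  obtain ⟨j, hj, hj'⟩ := hinv.exists_eraseIdx
  rw [← hv, huv] at hj'
  rw [List.length_append, List.length_singleton] at hj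
  rcases Nat.lt_or_ge j ω.length with hj2 | hj2
  · rw [List.eraseIdx_append_of_lt_length hj2, wordProd_append, wordProd_singleton] at hj'
    have h3 := cs.length_wordProd_le (ω.eraseIdx j)
    have h4 := List.length_eraseIdx_add_one hj2
    have h5 : cs.length (v * cs.simple i) = ω.length := by rw [he, hω.eq]
    rw [hj', simple_mul_simple_cancel_right] at h1
    rw [hj', simple_mul_simple_cancel_right] at hlt hne
    lia
  · obtain rfl : j = ω.length := by lia
    rw [List.eraseIdx_append_of_length_le le_rfl] at hj'
    simp only [Nat.sub_self, List.eraseIdx_zero, List.tail_cons, List.append_nil] at hj'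
    rw [hj', ← he, simple_mul_simple_cancel_right]

theorem BruhatLE.mul_simple_le_or {u v : W} (h : cs.BruhatLE u v) (i : B) :
    cs.BruhatLE (u * cs.simple i) v ∨ cs.BruhatLE (u * cs.simple i) (v * cs.simple i) := by
  induction h using Relation.ReflTransGen.head_induction_on with
  | refl => exact .inr (.refl _)
  | head h h' ih =>
    rcases h.mul_simple i with h1 | h1
    · exact .inl (h1 ▸ h')
    · exact ih.imp h1.le.trans h1.le.trans

theorem BruhatLE.le_mul_simple_or {u v : W} (h : cs.BruhatLE u v) (i : B) :
    cs.BruhatLE u (v * cs.simple i) ∨ cs.BruhatLE (u * cs.simple i) (v * cs.simple i) := by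
  induction h with
  | refl => exact .inr (.refl _)
  | tail h' h ih =>
    rcases h.mul_simple i with h1 | h1
    · left; rw [← h1, simple_mul_simple_cancel_right]; exact h'
    · exact ih.imp (·.trans h1.le) (·.trans h1.le)

theorem BruhatLE.mul_simple_le_of_isRightDescent {u v : W} {i : B} (h : cs.BruhatLE u v)
    (hi : cs.IsRightDescent v i) : cs.BruhatLE (u * cs.simple i) v := by
  refine (h.mul_simple_le_or i).elim id fun h' => h'.trans ?_
  have := cs.bruhatEdge_mul_simple (u := v * cs.simple i) (i := i)
    (by rwa [simple_mul_simple_cancel_right])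
  rw [simple_mul_simple_cancel_right] at this
  exact this.le

theorem BruhatLE.mul_simple_le_mul_simple {u v : W} {i : B} (h : cs.BruhatLE u v)
    (hi : ¬ cs.IsRightDescent v i) : cs.BruhatLE (u * cs.simple i) (v * cs.simple i) := by
  refine (h.mul_simple_le_or i).elim (fun h' => h'.trans ?_) id
  exact (cs.bruhatEdge_mul_simple (by rw [cs.not_isRightDescent_iff.1 hi]; lia)).le

/-- Only the larger product has to be length-additive: `x` is built one letter at a time, each
letter being an ascent on the side of `v`. -/
theorem BruhatLE.mul_right {u v : W} (h : cs.BruhatLE u v) {x : W}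
    (hx : cs.length (v * x) = cs.length v + cs.length x) :
    cs.BruhatLE (u * x) (v * x) := by
  induction hn : cs.length x generalizing x with
  | zero => rw [cs.length_eq_zero_iff] at hn; simpa [hn] using h
  | succ n ih =>
    have hx1 : x ≠ 1 := by rintro rfl; simp at hn
    obtain ⟨i, hi⟩ := cs.exists_rightDescent_of_ne_one hx1
    rw [isRightDescent_iff] at hi
    have h1 := cs.length_mul_le v (x * cs.simple i)
    have h2 := cs.length_mul_simple (v * x) i
    rw [← mul_assoc] at h1
    have h3 := ih (x := x * cs.simple i) (by rw [← mul_assoc]; lia) (by lia)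
    have h4 : ¬ cs.IsRightDescent (v * (x * cs.simple i)) i := by
      rw [IsRightDescent, ← mul_assoc, simple_mul_simple_cancel_right]; lia
    simpa [← mul_assoc] using h3.mul_simple_le_mul_simple h4

theorem BruhatLE.mul_left {u v : W} (h : cs.BruhatLE u v) {x : W}
    (hx : cs.length (x * v) = cs.length x + cs.length v) :
    cs.BruhatLE (x * u) (x * v) := by
  rw [← bruhatLE_inv_iff, mul_inv_rev, mul_inv_rev]
  refine h.inv.mul_right ?_
  rw [← mul_inv_rev]; simp only [length_inv]; lia

variable (cs)

theorem one_bruhatLE (x : W) : cs.BruhatLE 1 x := by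
  induction hn : cs.length x generalizing x with
  | zero => rw [cs.length_eq_zero_iff] at hn; rw [hn]; exact .refl _
  | succ n ih =>
    have hx1 : x ≠ 1 := by rintro rfl; simp at hn
    obtain ⟨i, hi⟩ := cs.exists_rightDescent_of_ne_one hx1
    have hi' := cs.isRightDescent_iff.1 hi
    refine (ih (x * cs.simple i) (by lia)).trans ?_
    exact (BruhatLE.refl x).mul_simple_le_of_isRightDescent hi

theorem bruhatLE_mul_right_of_length {x y : W}
    (h : cs.length (x * y) = cs.length x + cs.length y) : cs.BruhatLE x (x * y) := by
  simpa using (cs.one_bruhatLE y).mul_left h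

theorem bruhatLE_mul_left_of_length {x y : W}
    (h : cs.length (x * y) = cs.length x + cs.length y) : cs.BruhatLE y (x * y) := by
  simpa using (cs.one_bruhatLE x).mul_right h

theorem IsRightDescent.simple_le {x : W} {i : B} (h : cs.IsRightDescent x i) :
    cs.BruhatLE (cs.simple i) x := by
  simpa using (cs.one_bruhatLE x).mul_simple_le_of_isRightDescent h

/-- A simple reflection below `x sⱼ` lies below `x`, unless it is `sⱼ`. -/
theorem simple_le_of_le_mul_simple {x : W} {i j : B}
    (h : cs.BruhatLE (cs.simple i) (x * cs.simple j)) :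
    cs.BruhatLE (cs.simple i) x ∨ cs.simple i = cs.simple j := by
  have h1 := h.le_mul_simple_or j
  rw [simple_mul_simple_cancel_right] at h1
  rcases h1 with h1 | h1
  · exact .inl h1
  by_cases h2 : cs.IsRightDescent (cs.simple i) j
  · right
    rw [isRightDescent_iff, length_simple, Nat.add_eq_right, length_eq_zero_iff] at h2
    rw [eq_inv_of_mul_eq_one_left h2, inv_simple]
  · exact .inl ((cs.bruhatEdge_mul_simple (by rw [cs.not_isRightDescent_iff.1 h2]; lia)).le.trans h1)

/-- Multiply the edge from `x` to `sᵢ x` by `sⱼ`: if it survived, `sᵢ` would be a left ascent of `x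
sⱼ`. -/
theorem mul_simple_eq_simple_mul_of_isLeftDescent {x : W} {i j : B} (h : ¬ cs.IsLeftDescent x i)
    (h' : cs.IsLeftDescent (x * cs.simple j) i) : x * cs.simple j = cs.simple i * x := by
  have h1 := cs.bruhatEdge_simple_mul (u := x) (i := i) (by rw [cs.not_isLeftDescent_iff.1 h]; lia)
  refine (h1.mul_simple j).resolve_right fun h2 => ?_
  have := h2.2
  rw [IsLeftDescent, ← mul_assoc] at h'
  lia

theorem bruhatCovBy_mul_simple {u : W} {i : B} (h : ¬ cs.IsRightDescent u i) :
    cs.BruhatCovBy u (u * cs.simple i) := by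
  rw [not_isRightDescent_iff] at h
  refine ⟨(cs.bruhatEdge_mul_simple (by lia)).le, fun he => by rw [← he] at h; lia, ?_⟩
  intro z h1 h2
  have h3 := h1.length_le
  have h4 := h2.length_le
  rcases Nat.eq_or_lt_of_le h3 with h5 | h5
  · exact .inl (h1.eq_of_length_le h5.ge).symm
  · exact .inr (h2.eq_of_length_le (by lia))

theorem isMatching_rho {w : W} {i : B} (h : cs.IsRightDescent w i) :
    cs.IsMatching w (cs.rho i) where
  mapsTo u hu := hu.mul_simple_le_of_isRightDescent h
  involutive u _ := by simp [rho]
  edge u _ := by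
    by_cases hd : cs.IsRightDescent u i
    · right
      have := cs.bruhatCovBy_mul_simple (cs.isRightDescent_iff_not_isRightDescent_mul.1 hd)
      rwa [simple_mul_simple_cancel_right] at this
    · exact .inl (cs.bruhatCovBy_mul_simple hd)

theorem isRightMulMatching_rho {w : W} {i : B} (h : cs.IsRightDescent w i) :
    cs.IsRightMulMatching w (cs.rho i) :=
  ⟨cs.isMatching_rho h, i, h, fun _ _ => rfl⟩

end CoxeterSystem

namespace CoxeterSystem

variable {B W : Type*} [Group W] {C : CoxeterMatrix B} (cs : CoxeterSystem C W)

/-! ### Simple reflections of a doubly laced Coxeter group are distinct -/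

/-- The value `-2 cos (π / m)` for `m ≤ 4`. -/
noncomputable def cartanEntry : ℕ → ℝ
  | 1 => 2
  | 3 => -1
  | 4 => -√2
  -- Under `IsDoublyLaced` only the entry 2 reaches this branch.
  | _ => 0

/-- The reflections of the dual of the geometric representation. -/
noncomputable def geomReflection (C : CoxeterMatrix B) (i : B) : Function.End (B → ℝ) :=
  fun φ k => φ k - cartanEntry (C i k) * φ i

theorem _root_.CoxeterMatrix.IsDoublyLaced.isLiftable_geomReflection (hC : C.IsDoublyLaced) :
    C.IsLiftable (geomReflection C) := by
  intro i j
  obtain ⟨h0, h4⟩ := hC i j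
  have hs : C j i = C i j := C.symmetric j i
  have hi (l : B) : cartanEntry (C l l) = 2 := by rw [C.diagonal]; rfl
  have hc2 : cartanEntry 2 = 0 := rfl
  have hc3 : cartanEntry 3 = -1 := rfl
  have hc4 : cartanEntry 4 = -√2 := rfl
  have h2 : √2 * √2 = (2 : ℝ) := Real.mul_self_sqrt (by norm_num)
  funext φ k
  change _ = φ k
  rcases (by lia : C i j = 1 ∨ C i j = 2 ∨ C i j = 3 ∨ C i j = 4) with h | h | h | h
  · have : i = j := by by_contra hne; exact C.off_diagonal i j hne h
    subst this
    rw [h, pow_one, Function.End.mul_apply_eq]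
    simp only [geomReflection, hi]
    ring
  · simp only [h, pow_succ, pow_zero, one_mul, Function.End.mul_apply_eq, geomReflection, hi, hs,
      hc2]
    ring
  · simp only [h, pow_succ, pow_zero, one_mul, Function.End.mul_apply_eq, geomReflection, hi, hs,
      hc3]
    ring
  · simp only [h, pow_succ, pow_zero, one_mul, Function.End.mul_apply_eq, geomReflection, hi, hs,
      hc4]
    have h3 : √2 ^ 2 = (2 : ℝ) := by rw [sq, h2]
    have h4 : √2 ^ 3 = 2 * √2 := by rw [pow_succ, h3]
    have h5 : √2 ^ 4 = (4 : ℝ) := by rw [pow_succ, h4, mul_assoc, h2]; norm_num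
    have h6 : √2 ^ 5 = 4 * √2 := by rw [pow_succ, h5]
    have h7 : √2 ^ 6 = (8 : ℝ) := by rw [pow_succ, h6, mul_assoc, h2]; norm_num
    have h8 : √2 ^ 7 = 8 * √2 := by rw [pow_succ, h7]
    ring_nf
    simp only [h3, h4, h5, h6, h7, h8]
    ring

theorem simple_injective (hC : C.IsDoublyLaced) : Function.Injective cs.simple := by
  classical
  intro i j hij
  by_contra hne
  have h : geomReflection C i = geomReflection C j := by
    rw [← cs.lift_apply_simple hC.isLiftable_geomReflection i, hij, cs.lift_apply_simple]
  -- At coordinate `i` of the basis vector, the reflection of `i` gives `-1` and that of `j ≠ i`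
  -- gives `1`.
  have h1 := congrFun (congrFun h (Pi.single i 1)) i
  simp [geomReflection, cartanEntry, Ne.symm hne] at h1

/-! ### Parabolic subgroups -/

variable {J : Set B}

theorem simple_mem_parabolic {i : B} (hi : i ∈ J) : cs.simple i ∈ cs.parabolic J :=
  Subgroup.subset_closure (Set.mem_image_of_mem _ hi)

theorem parabolic_mono {K : Set B} (h : J ⊆ K) : cs.parabolic J ≤ cs.parabolic K :=
  Subgroup.closure_mono (Set.image_mono h)

theorem wordProd_mem_parabolic {ω : List B} (h : ∀ i ∈ ω, i ∈ J) :
    cs.wordProd ω ∈ cs.parabolic J := by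
  refine Subgroup.list_prod_mem _ fun x hx => ?_
  obtain ⟨i, hi, rfl⟩ := List.mem_map.1 hx
  exact cs.simple_mem_parabolic (h i hi)

/-- Every word has a reduced subword with the same product. -/
theorem exists_isReduced_subset (ω : List B) :
    ∃ ω', cs.IsReduced ω' ∧ cs.wordProd ω' = cs.wordProd ω ∧ ω' ⊆ ω := by
  induction ω using List.reverseRecOn with
  | nil => exact ⟨[], by simp [IsReduced], rfl, by simp⟩
  | append_singleton ω i ih =>
    obtain ⟨ω', hr, he, hs⟩ := ih
    have he' : cs.wordProd (ω' ++ [i]) = cs.wordProd (ω ++ [i]) := by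
      rw [wordProd_append, wordProd_append, he]
    by_cases hd : cs.IsRightDescent (cs.wordProd ω') i
    · obtain ⟨j, hj, hj'⟩ := ((cs.isRightInversion_simple_iff_isRightDescent _ _).2
        hd).exists_eraseIdx
      refine ⟨ω'.eraseIdx j, ?_, ?_, ?_⟩
      · have h1 := List.length_eraseIdx_add_one hj
        rw [isRightDescent_iff, hr.eq] at hd
        rw [IsReduced, ← hj']; lia
      · rw [← he', ← hj', wordProd_append, wordProd_singleton]
      · exact fun x hx => List.mem_append_left _ (hs (List.eraseIdx_subset hx))
    · refine ⟨ω' ++ [i], ?_, he', ?_⟩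
      · rw [not_isRightDescent_iff, hr.eq] at hd
        rw [IsReduced, wordProd_append, wordProd_singleton, hd]; simp
      · exact fun x hx => (List.mem_append.1 hx).elim (fun h => List.mem_append_left _ (hs h))
          (List.mem_append_right _)

theorem exists_wordProd_of_mem_parabolic {w : W} (h : w ∈ cs.parabolic J) :
    ∃ ω, cs.IsReduced ω ∧ cs.wordProd ω = w ∧ ∀ i ∈ ω, i ∈ J := by
  suffices ∃ ω, cs.wordProd ω = w ∧ ∀ i ∈ ω, i ∈ J by
    obtain ⟨ω, h1, h2⟩ := this
    obtain ⟨ω', h3, h4, h5⟩ := cs.exists_isReduced_subset ω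
    exact ⟨ω', h3, h4.trans h1, fun i hi => h2 i (h5 hi)⟩
  induction h using Subgroup.closure_induction with
  | mem x hx => obtain ⟨i, hi, rfl⟩ := hx; exact ⟨[i], by simp, by simpa using hi⟩
  | one => exact ⟨[], by simp⟩
  | mul x y _ _ hx hy =>
    obtain ⟨ω, rfl, h⟩ := hx
    obtain ⟨ω', rfl, h'⟩ := hy
    exact ⟨ω ++ ω', cs.wordProd_append _ _, fun i hi => (List.mem_append.1 hi).elim (h i) (h' i)⟩
  | inv x _ hx =>
    obtain ⟨ω, rfl, h⟩ := hx
    exact ⟨ω.reverse, cs.wordProd_reverse ω, fun i hi => h i (List.mem_reverse.1 hi)⟩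

variable {cs}

/-- By strong exchange, each step down the Bruhat graph deletes a letter from a word in `J`. -/
theorem BruhatLE.mem_parabolic {u w : W} (h : cs.BruhatLE u w) (hw : w ∈ cs.parabolic J) :
    u ∈ cs.parabolic J := by
  induction h using Relation.ReflTransGen.head_induction_on with
  | refl => exact hw
  | @head a c h _ ih =>
    obtain ⟨ω, _, rfl, hJ⟩ := cs.exists_wordProd_of_mem_parabolic ih
    have hu : cs.wordProd ω * (a⁻¹ * cs.wordProd ω) = a := by
      rw [← h.1.inv]; group
    have hi : cs.IsRightInversion (cs.wordProd ω) (a⁻¹ * cs.wordProd ω) :=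
      ⟨h.1, by rw [hu]; exact h.2⟩
    obtain ⟨j, _, hj⟩ := hi.exists_eraseIdx
    rw [← hu, hj]
    exact cs.wordProd_mem_parabolic fun i hi => hJ i (List.eraseIdx_subset hi)

theorem IsReduced.simple_le {ω : List B} (h : cs.IsReduced ω) {i : B} (hi : i ∈ ω) :
    cs.BruhatLE (cs.simple i) (cs.wordProd ω) := by
  obtain ⟨ω₁, ω₂, rfl⟩ := List.append_of_mem hi
  have h1 := h.eq
  have h2 := cs.length_wordProd_le ω₁
  have h3 := cs.length_wordProd_le ω₂
  have h4 := cs.length_mul_le (cs.wordProd ω₁) (cs.simple i * cs.wordProd ω₂)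
  have h5 := cs.length_mul_le (cs.simple i) (cs.wordProd ω₂)
  rw [length_simple] at h5
  rw [wordProd_append, wordProd_cons] at h1 ⊢
  rw [List.length_append, List.length_cons] at h1
  exact (cs.bruhatLE_mul_right_of_length (by rw [length_simple]; lia)).trans
    (cs.bruhatLE_mul_left_of_length (by lia))

variable (cs)

theorem eq_one_of_mem {x : W} (hx : x ∈ cs.minCosetReps J) (h : x ∈ cs.parabolic J) : x = 1 := by
  obtain ⟨ω, hr, rfl, hJ⟩ := cs.exists_wordProd_of_mem_parabolic h
  rcases List.eq_nil_or_concat ω with rfl | ⟨ω, i, rfl⟩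
  · simp
  · exfalso
    refine hx i (hJ i (by simp)) ?_
    rw [IsRightDescent, hr.eq, wordProd_concat, simple_mul_simple_cancel_right]
    exact (cs.length_wordProd_le ω).trans_lt (by simp)

/-- Append a reduced word of `y` letter by letter. If a letter shortened the product, exchange would
delete a letter of `x`, giving a shorter element of `x W_J`, or a letter of the word of `y`,
contradicting reducedness. -/
theorem length_mul_of_forall_le {x y : W} (hx : ∀ z ∈ cs.parabolic J, cs.length x ≤ cs.length (x * z))
    (hy : y ∈ cs.parabolic J) : cs.length (x * y) = cs.length x + cs.length y := by
  obtain ⟨ω, hr, rfl, hJ⟩ := cs.exists_wordProd_of_mem_parabolic hy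
  clear hy
  induction ω using List.reverseRecOn with
  | nil => simp
  | append_singleton ω i ih =>
    have hr' : cs.IsReduced ω := by simpa using hr.take ω.length
    have hJ' : ∀ j ∈ ω, j ∈ J := fun j hj => hJ j (List.mem_append_left _ hj)
    have hJi : i ∈ J := hJ i (by simp)
    specialize ih hr' hJ'
    rw [hr.eq, List.length_append, List.length_singleton, wordProd_append, wordProd_singleton,
      ← mul_assoc]
    rw [hr'.eq] at ih
    have h1 := cs.length_mul_simple (x * cs.wordProd ω) i
    by_contra hne
    obtain ⟨α, hα, rfl⟩ := cs.exists_isReduced x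
    have hd : cs.IsRightInversion (cs.wordProd (α ++ ω)) (cs.simple i) := by
      refine ⟨cs.isReflection_simple i, ?_⟩
      rw [wordProd_append]; lia
    obtain ⟨j, hj, hj'⟩ := hd.exists_eraseIdx
    rcases Nat.lt_or_ge j α.length with hj2 | hj2
    · rw [List.eraseIdx_append_of_lt_length hj2, wordProd_append, wordProd_append] at hj'
      have h2 := hx (cs.wordProd ω * cs.simple i * (cs.wordProd ω)⁻¹)
        (mul_mem (mul_mem (cs.wordProd_mem_parabolic hJ') (cs.simple_mem_parabolic hJi))
          (inv_mem (cs.wordProd_mem_parabolic hJ')))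
      rw [← mul_assoc, ← mul_assoc, hj', mul_inv_cancel_right, hα.eq] at h2
      have h3 := cs.length_wordProd_le (α.eraseIdx j)
      have h4 := List.length_eraseIdx_add_one hj2
      lia
    · rw [List.length_append] at hj
      rw [List.eraseIdx_append_of_length_le hj2, wordProd_append, wordProd_append, mul_assoc,
        mul_right_inj] at hj'
      have h2 := hr.eq
      rw [wordProd_append, wordProd_singleton, hj', List.length_append, List.length_singleton] at h2
      have h3 := cs.length_wordProd_le (ω.eraseIdx (j - α.length))
      have h4 := List.length_eraseIdx_add_one (l := ω) (i := j - α.length) (by lia)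
      lia

theorem length_mul_of_mem {x y : W} (hx : x ∈ cs.minCosetReps J) (hy : y ∈ cs.parabolic J) :
    cs.length (x * y) = cs.length x + cs.length y := by
  refine cs.length_mul_of_forall_le ?_ hy
  obtain ⟨z, hz, hmin⟩ := (measure fun z => cs.length (x * z)).wf.has_min
    (cs.parabolic J) ⟨1, (cs.parabolic J).one_mem⟩
  have hmin' : ∀ y ∈ cs.parabolic J, cs.length (x * z) ≤ cs.length (x * z * y) := fun y hy => by
    have : ¬ cs.length (x * (z * y)) < cs.length (x * z) := hmin (z * y) (mul_mem hz hy)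
    rw [mul_assoc]; lia
  -- With `x * z` of minimal length in the coset, `x = (x * z) * z⁻¹` is length-additive, so a right
  -- descent of `z⁻¹` in `J` would be one of `x`.
  have hz1 : z⁻¹ = 1 := by
    refine cs.eq_one_of_mem (J := J) (fun j hj hd => hx j hj ?_) (inv_mem hz)
    have h1 := cs.length_mul_of_forall_le hmin' (inv_mem hz)
    have h2 := cs.length_mul_of_forall_le hmin' (mul_mem (inv_mem hz) (cs.simple_mem_parabolic hj))
    rw [mul_inv_cancel_right] at h1
    rw [← mul_assoc, mul_inv_cancel_right] at h2
    rw [IsRightDescent] at hd ⊢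
    lia
  rw [inv_eq_one] at hz1
  simpa [hz1] using hmin'

/-! ### Uniqueness of parabolic factorizations -/

theorem length_upR_add_length_lowR (J : Set B) (w : W) :
    cs.length w = cs.length (cs.upR J w) + cs.length (cs.lowR J w) := by
  rw [← cs.length_mul_of_mem (cs.upR_mem J w) (cs.lowR_mem J w), upR_mul_lowR]

theorem length_lowL_add_length_upL (J : Set B) (w : W) :
    cs.length w = cs.length (cs.lowL J w) + cs.length (cs.upL J w) := by
  rw [lowL, upL, length_inv, length_inv, ← length_inv, cs.length_upR_add_length_lowR J, add_comm]

/-- Each of `x`, `x'` is the other times an element of `W_J`, with additive lengths; comparing both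
ways, that element has length 0. -/
theorem factorization_unique {x x' y y' : W} (hx : x ∈ cs.minCosetReps J)
    (hx' : x' ∈ cs.minCosetReps J) (hy : y ∈ cs.parabolic J) (hy' : y' ∈ cs.parabolic J)
    (h : x * y = x' * y') : x = x' ∧ y = y' := by
  have h1 := cs.length_mul_of_mem hx (mul_mem hy (inv_mem hy'))
  have h2 := cs.length_mul_of_mem hx' (mul_mem hy' (inv_mem hy))
  rw [← mul_assoc, h, mul_inv_cancel_right] at h1
  rw [← mul_assoc, ← h, mul_inv_cancel_right] at h2
  have h3 : y * y'⁻¹ = 1 := by rw [← cs.length_eq_zero_iff]; lia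
  rw [mul_inv_eq_one] at h3
  subst h3
  exact ⟨mul_right_cancel h, rfl⟩

theorem upR_mul_eq {x y : W} (hx : x ∈ cs.minCosetReps J) (hy : y ∈ cs.parabolic J) :
    cs.upR J (x * y) = x ∧ cs.lowR J (x * y) = y :=
  cs.factorization_unique (cs.upR_mem J _) hx (cs.lowR_mem J _) hy (cs.upR_mul_lowR J _)

theorem lowL_mul_eq {x y : W} (hx : ∀ j ∈ J, ¬ cs.IsLeftDescent x j) (hy : y ∈ cs.parabolic J) :
    cs.lowL J (y * x) = y ∧ cs.upL J (y * x) = x := by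
  have hx' : x⁻¹ ∈ cs.minCosetReps J := fun j hj => by
    rw [isRightDescent_inv_iff]; exact hx j hj
  have := cs.upR_mul_eq hx' (inv_mem hy)
  rw [← mul_inv_rev] at this
  exact ⟨by rw [lowL, this.2, inv_inv], by rw [upL, this.1, inv_inv]⟩

theorem mem_parabolic_singleton {i : B} {x : W} (h : x ∈ cs.parabolic {i}) :
    x = 1 ∨ x = cs.simple i := by
  induction h using Subgroup.closure_induction with
  | mem x hx => obtain ⟨j, rfl, rfl⟩ := hx; exact .inr rfl
  | one => exact .inl rfl
  | mul x y _ _ hx hy => rcases hx with rfl | rfl <;> rcases hy with rfl | rfl <;> simp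
  | inv x _ hx => rcases hx with rfl | rfl <;> simp

theorem mem_of_simple_mem_parabolic (hC : C.IsDoublyLaced) {i : B}
    (h : cs.simple i ∈ cs.parabolic J) : i ∈ J := by
  obtain ⟨ω, hr, he, hJ⟩ := cs.exists_wordProd_of_mem_parabolic h
  have h1 := hr.eq
  rw [he, length_simple] at h1
  obtain ⟨j, rfl⟩ := List.length_eq_one_iff.1 h1.symm
  rw [wordProd_singleton] at he
  rw [← cs.simple_injective hC he]
  exact hJ j (by simp)

/-- If every simple reflection below `x` lies in `W_K`, then `x ∈ W_K`. -/
theorem mem_parabolic_of_simple_le {x : W}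
    (h : ∀ i, cs.BruhatLE (cs.simple i) x → i ∈ J) : x ∈ cs.parabolic J := by
  obtain ⟨ω, hr, rfl⟩ := cs.exists_isReduced x
  exact cs.wordProd_mem_parabolic fun i hi => h i (hr.simple_le hi)

theorem mem_parabolic_inter (hC : C.IsDoublyLaced) {K : Set B} {x : W} (h : x ∈ cs.parabolic J)
    (h' : x ∈ cs.parabolic K) : x ∈ cs.parabolic (J ∩ K) :=
  cs.mem_parabolic_of_simple_le fun _ hi => ⟨cs.mem_of_simple_mem_parabolic hC (hi.mem_parabolic h),
    cs.mem_of_simple_mem_parabolic hC (hi.mem_parabolic h')⟩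

/-- Elements below a product factor into elements below the factors. -/
theorem exists_mul_of_le_mul {x y z : W} (h : cs.BruhatLE z (x * y)) :
    ∃ z₁ z₂, cs.BruhatLE z₁ x ∧ cs.BruhatLE z₂ y ∧ z = z₁ * z₂ := by
  induction hn : cs.length y generalizing y z with
  | zero =>
    rw [cs.length_eq_zero_iff] at hn
    subst hn
    exact ⟨z, 1, by simpa using h, .refl _, by simp⟩
  | succ n ih =>
    have hy1 : y ≠ 1 := by rintro rfl; simp at hn
    obtain ⟨i, hi⟩ := cs.exists_rightDescent_of_ne_one hy1
    have hi' := cs.isRightDescent_iff.1 hi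
    have hle : cs.BruhatLE (y * cs.simple i) y := (BruhatLE.refl y).mul_simple_le_of_isRightDescent hi
    rcases h.le_mul_simple_or i with h1 | h1
    · rw [mul_assoc] at h1
      obtain ⟨z₁, z₂, h2, h3, rfl⟩ := ih h1 (by lia)
      exact ⟨z₁, z₂, h2, h3.trans hle, rfl⟩
    · rw [mul_assoc x] at h1
      obtain ⟨z₁, z₂, h2, h3, h4⟩ := ih h1 (by lia)
      refine ⟨z₁, z₂ * cs.simple i, h2, (h3.trans hle).mul_simple_le_of_isRightDescent hi, ?_⟩
      rw [← mul_assoc, ← h4, simple_mul_simple_cancel_right]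

end CoxeterSystem

namespace CoxeterSystem

variable {B W : Type*} [Group W] {C : CoxeterMatrix B} (cs : CoxeterSystem C W)

/-! ### Dihedral parabolic subgroups -/

theorem simple_ne_one (i : B) : cs.simple i ≠ 1 := fun h => by
  have := cs.length_simple i
  rw [h, length_one] at this
  lia

theorem length_simple_mul_simple {i j : B} (h : cs.simple i ≠ cs.simple j) :
    cs.length (cs.simple i * cs.simple j) = 2 := by
  have h1 := cs.length_mul_simple (cs.simple i) j
  rw [length_simple] at h1
  refine h1.resolve_right fun h2 => h ?_
  rw [Nat.add_eq_right, length_eq_zero_iff] at h2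
  rw [eq_inv_of_mul_eq_one_left h2, inv_simple]

theorem length_simple_mul_simple_mul_simple {i j : B} (h : cs.simple i ≠ cs.simple j)
    (hc : cs.simple i * cs.simple j ≠ cs.simple j * cs.simple i) :
    cs.length (cs.simple i * cs.simple j * cs.simple i) = 3 := by
  have h1 := cs.length_mul_simple (cs.simple i * cs.simple j) i
  rw [cs.length_simple_mul_simple h] at h1
  refine h1.resolve_right fun h2 => ?_
  have hd : cs.IsRightInversion (cs.wordProd [i, j]) (cs.simple i) := by
    refine ⟨cs.isReflection_simple i, ?_⟩
    simp only [wordProd_cons, wordProd_nil, mul_one, cs.length_simple_mul_simple h]; lia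
  obtain ⟨k, hk, he⟩ := hd.exists_eraseIdx
  simp only [List.length_cons, List.length_nil] at hk
  interval_cases k
  · simp only [wordProd_cons, wordProd_nil, mul_one, List.eraseIdx_zero, List.tail_cons] at he
    apply hc
    rw [← mul_inv_eq_iff_eq_mul.2 he.symm, inv_simple]
  · simp [wordProd_cons, mul_assoc] at he
    apply h
    rw [eq_inv_of_mul_eq_one_right he, inv_simple]

theorem length_simple_mul_four {i j : B} (h : cs.simple i ≠ cs.simple j)
    (hc : cs.simple i * cs.simple j ≠ cs.simple j * cs.simple i)
    (hb : cs.simple i * cs.simple j * cs.simple i ≠ cs.simple j * cs.simple i * cs.simple j) :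
    cs.length (cs.simple i * cs.simple j * cs.simple i * cs.simple j) = 4 := by
  have h1 := cs.length_mul_simple (cs.simple i * cs.simple j * cs.simple i) j
  rw [cs.length_simple_mul_simple_mul_simple h hc] at h1
  refine h1.resolve_right fun h2 => ?_
  have hd : cs.IsRightInversion (cs.wordProd [i, j, i]) (cs.simple j) := by
    refine ⟨cs.isReflection_simple j, ?_⟩
    simp only [wordProd_cons, wordProd_nil, mul_one, ← mul_assoc,
      cs.length_simple_mul_simple_mul_simple h hc]
    lia
  obtain ⟨k, hk, he⟩ := hd.exists_eraseIdx
  simp only [List.length_cons, List.length_nil] at hk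
  interval_cases k
  · simp only [wordProd_cons, wordProd_nil, mul_one, List.eraseIdx_zero, List.tail_cons,
      ← mul_assoc] at he
    apply hb
    rw [← he, simple_mul_simple_cancel_right]
  · simp [wordProd_cons, ← mul_assoc] at he
    apply hc
    have h5 := eq_inv_of_mul_eq_one_left he
    rw [inv_simple] at h5
    rw [← h5]; simpa using h5
  · simp [wordProd_cons, mul_assoc] at he
    apply h
    rw [eq_inv_of_mul_eq_one_left he, inv_simple]

theorem mem_parabolic_pair_of_commute {i j : B} {x : W} (hx : x ∈ cs.parabolic {i, j})
    (h : cs.simple i * cs.simple j = cs.simple j * cs.simple i) :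
    x = 1 ∨ x = cs.simple i ∨ x = cs.simple j ∨ x = cs.simple j * cs.simple i := by
  obtain ⟨ω, hr, rfl, hω⟩ := cs.exists_wordProd_of_mem_parabolic hx
  clear hx hr
  induction ω using List.reverseRecOn with
  | nil => simp
  | append_singleton ω k ih =>
    have ih := ih fun l hl => hω l (by simp [hl])
    have hk : k = i ∨ k = j := by simpa using hω k (by simp)
    rw [wordProd_append, wordProd_singleton]
    rcases hk with rfl | rfl <;>
    rcases ih with h1 | h1 | h1 | h1 <;> rw [h1] <;> first
      | (simp; done)
      | (rw [← h]; simp)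

theorem mem_parabolic_pair_of_braid_three {i j : B} {x : W} (hx : x ∈ cs.parabolic {i, j})
    (h : cs.simple i * cs.simple j * cs.simple i = cs.simple j * cs.simple i * cs.simple j) :
    x = 1 ∨ x = cs.simple i ∨ x = cs.simple j ∨ x = cs.simple i * cs.simple j ∨
      x = cs.simple j * cs.simple i ∨ x = cs.simple i * cs.simple j * cs.simple i := by
  obtain ⟨ω, hr, rfl, hω⟩ := cs.exists_wordProd_of_mem_parabolic hx
  clear hx hr
  induction ω using List.reverseRecOn with
  | nil => simp
  | append_singleton ω k ih =>
    have ih := ih fun l hl => hω l (by simp [hl])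
    have hk : k = i ∨ k = j := by simpa using hω k (by simp)
    rw [wordProd_append, wordProd_singleton]
    rcases hk with rfl | rfl <;>
    rcases ih with h1 | h1 | h1 | h1 | h1 | h1 <;> rw [h1] <;> first
      | (simp; done)
      | (rw [← h]; simp)
      | (rw [h]; simp)

theorem mem_parabolic_pair_of_braid_four {i j : B} {x : W} (hx : x ∈ cs.parabolic {i, j})
    (h : cs.simple i * cs.simple j * cs.simple i * cs.simple j =
      cs.simple j * cs.simple i * cs.simple j * cs.simple i) :
    x = 1 ∨ x = cs.simple i ∨ x = cs.simple j ∨ x = cs.simple i * cs.simple j ∨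
      x = cs.simple j * cs.simple i ∨ x = cs.simple i * cs.simple j * cs.simple i ∨
      x = cs.simple j * cs.simple i * cs.simple j ∨
      x = cs.simple i * cs.simple j * cs.simple i * cs.simple j := by
  obtain ⟨ω, hr, rfl, hω⟩ := cs.exists_wordProd_of_mem_parabolic hx
  clear hx hr
  induction ω using List.reverseRecOn with
  | nil => simp
  | append_singleton ω k ih =>
    have ih := ih fun l hl => hω l (by simp [hl])
    have hk : k = i ∨ k = j := by simpa using hω k (by simp)
    rw [wordProd_append, wordProd_singleton]
    rcases hk with rfl | rfl <;>
    rcases ih with h1 | h1 | h1 | h1 | h1 | h1 | h1 | h1 <;> rw [h1] <;> first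
      | (simp; done)
      | (rw [← h]; simp)
      | (rw [h]; simp)

variable {cs}

/-- A matching `N` of an element of `W_{s,t}` with `N e = s` and `N t = ts` is `ρ_s`, unless
`m(s,t) = 4` and the element is `tst` or `stst`. -/
theorem IsMatching.dihedral (hC : C.IsDoublyLaced) {s t : B} {m : W} {N : W → W}
    (hst : s ≠ t) (hm : m ∈ cs.parabolic {s, t}) (hN : cs.IsMatching m N)
    (h1 : N 1 = cs.simple s) (ht : cs.BruhatLE (cs.simple t) m)
    (h2 : N (cs.simple t) = cs.simple t * cs.simple s)
    (hne : ¬ ∀ x, cs.BruhatLE x m → N x = cs.rho s x) :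
    C s t = 4 ∧
    cs.simple s * cs.simple t * cs.simple s ≠ cs.simple t * cs.simple s * cs.simple t ∧
    cs.length (cs.simple t * cs.simple s * cs.simple t) = 3 ∧
    cs.length (cs.simple s * cs.simple t * cs.simple s * cs.simple t) = 4 ∧
    cs.simple s * cs.simple t * cs.simple s * cs.simple t =
      cs.simple t * cs.simple s * cs.simple t * cs.simple s ∧
    N (cs.simple s * cs.simple t) = cs.simple t * cs.simple s * cs.simple t ∧
    (m = cs.simple t * cs.simple s * cs.simple t ∨
      m = cs.simple s * cs.simple t * cs.simple s * cs.simple t ∧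
      N (cs.simple s * cs.simple t * cs.simple s) =
        cs.simple s * cs.simple t * cs.simple s * cs.simple t ∧
      ∀ x ∈ cs.parabolic {s, t}, N (x * cs.simple s) = N x * cs.simple s) := by
  have hab : cs.simple s ≠ cs.simple t := fun h => hst (cs.simple_injective hC h)
  have hone : cs.BruhatLE 1 m := cs.one_bruhatLE m
  have hs : cs.BruhatLE (cs.simple s) m := h1 ▸ hN.mapsTo 1 hone
  have h3 : N (cs.simple s) = 1 := by rw [← h1, hN.involutive 1 hone]
  have h4 : N (cs.simple t * cs.simple s) = cs.simple t := by rw [← h2, hN.involutive _ ht]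
  have hmem : ∀ x, cs.BruhatLE x m → N x ∈ cs.parabolic {s, t} := fun x hx =>
    (hN.mapsTo x hx).mem_parabolic hm
  have hself : ∀ x, cs.BruhatLE x m → N x ≠ x := fun x hx he => by
    rcases hN.edge x hx with h | h
    · exact h.2.1 he.symm
    · exact h.2.1 he
  have hinv : ∀ x y, cs.BruhatLE x m → N x = y → x = N y := fun x y hx he => by
    rw [← he, hN.involutive x hx]
  -- When `s` and `t` commute, the prescribed values already cover all of `W_{s,t}`.
  by_cases hcomm : cs.simple s * cs.simple t = cs.simple t * cs.simple s
  · exfalso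
    refine hne fun x hx => ?_
    rcases cs.mem_parabolic_pair_of_commute (hx.mem_parabolic hm) hcomm with rfl | rfl | rfl | rfl
    all_goals simp [rho, h1, h2, h3, h4]
  -- an element on which `N` is not prescribed is not mapped to `e`, `s`, `t` or `ts`
  have hout : ∀ x, cs.BruhatLE x m → x ≠ 1 → x ≠ cs.simple s → x ≠ cs.simple t →
      x ≠ cs.simple t * cs.simple s → N x ≠ 1 ∧ N x ≠ cs.simple s ∧ N x ≠ cs.simple t ∧
        N x ≠ cs.simple t * cs.simple s := by
    intro x hx e1 e2 e3 e4
    refine ⟨fun e => e2 ?_, fun e => e1 ?_, fun e => e4 ?_, fun e => e3 ?_⟩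
    · rw [hinv x _ hx e, h1]
    · rw [hinv x _ hx e, h3]
    · rw [hinv x _ hx e, h2]
    · rw [hinv x _ hx e, h4]
  have l2 := cs.length_simple_mul_simple hab
  have l2' := cs.length_simple_mul_simple hab.symm
  have l3 := cs.length_simple_mul_simple_mul_simple hab hcomm
  have l3' := cs.length_simple_mul_simple_mul_simple hab.symm (Ne.symm hcomm)
  have hnot : ∀ x, 3 ≤ cs.length x → x ≠ 1 ∧ x ≠ cs.simple s ∧ x ≠ cs.simple t ∧
      x ≠ cs.simple t * cs.simple s ∧ x ≠ cs.simple s * cs.simple t := by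
    intro x hx
    refine ⟨?_, ?_, ?_, ?_, ?_⟩ <;> rintro rfl <;>
      simp only [length_one, length_simple, l2, l2'] at hx <;> lia
  have hst1 : cs.simple s * cs.simple t ≠ 1 := fun e => by rw [e, length_one] at l2; lia
  have hst2 : cs.simple s * cs.simple t ≠ cs.simple s := fun e => by
    rw [e, length_simple] at l2; lia
  have hst3 : cs.simple s * cs.simple t ≠ cs.simple t := fun e => by
    rw [e, length_simple] at l2; lia
  -- Under the length-three braid relation only `st` and `sts` are left, so `N` has to exchange
  -- them, as `ρ_s` does.
  by_cases hbraid : cs.simple s * cs.simple t * cs.simple s =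
      cs.simple t * cs.simple s * cs.simple t
  · exfalso
    refine hne fun x hx => ?_
    rcases cs.mem_parabolic_pair_of_braid_three (hx.mem_parabolic hm) hbraid with
      rfl | rfl | rfl | rfl | rfl | rfl
    · simp [rho, h1]
    · simp [rho, h3]
    · simp [rho, h2]
    · obtain ⟨o1, o2, o3, o4⟩ := hout _ hx hst1 hst2 hst3 hcomm
      have := cs.mem_parabolic_pair_of_braid_three (hmem _ hx) hbraid
      have o5 := hself _ hx
      rw [rho]
      tauto
    · simp [rho, h4]
    · obtain ⟨n1, n2, n3, n4, n5⟩ := hnot _ l3.ge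
      obtain ⟨o1, o2, o3, o4⟩ := hout _ hx n1 n2 n3 n4
      have := cs.mem_parabolic_pair_of_braid_three (hmem _ hx) hbraid
      have o5 := hself _ hx
      rw [rho, simple_mul_simple_cancel_right]
      tauto
  have l4 := cs.length_simple_mul_four hab hcomm hbraid
  have hpow := cs.simple_mul_simple_pow s t
  obtain ⟨hC0, hC4⟩ := hC s t
  have hCst : C s t = 4 := by
    rcases (by lia : C s t = 1 ∨ C s t = 2 ∨ C s t = 3 ∨ C s t = 4) with h | h | h | h
    · exact absurd h (C.off_diagonal s t hst)
    · rw [h, pow_two, mul_eq_one_iff_eq_inv, mul_inv_rev, inv_simple, inv_simple] at hpow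
      exact absurd hpow hcomm
    · refine absurd ?_ hbraid
      have h' : cs.simple s * cs.simple t * cs.simple s *
          (cs.simple t * cs.simple s * cs.simple t) = 1 := by
        rw [← hpow, h]; simp [pow_succ, mul_assoc]
      rw [eq_inv_of_mul_eq_one_left h']
      simp [mul_assoc]
    · exact h
  have hbraid4 : cs.simple s * cs.simple t * cs.simple s * cs.simple t =
      cs.simple t * cs.simple s * cs.simple t * cs.simple s := by
    rw [hCst, show 4 = 2 + 2 from rfl, pow_add, pow_two, mul_eq_one_iff_eq_inv] at hpow
    simpa [mul_assoc] using hpow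
  have e1 : cs.BruhatLE (cs.simple s * cs.simple t) (cs.simple s * cs.simple t * cs.simple s) :=
    (cs.bruhatEdge_mul_simple (by lia)).le
  have e2 : cs.BruhatLE (cs.simple s * cs.simple t) (cs.simple t * cs.simple s * cs.simple t) := by
    rw [mul_assoc] at l3' ⊢
    exact (cs.bruhatEdge_simple_mul (by lia)).le
  have e3 : cs.BruhatLE (cs.simple s * cs.simple t * cs.simple s)
      (cs.simple s * cs.simple t * cs.simple s * cs.simple t) :=
    (cs.bruhatEdge_mul_simple (by lia)).le
  have e4 : cs.BruhatLE (cs.simple t * cs.simple s * cs.simple t)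
      (cs.simple s * cs.simple t * cs.simple s * cs.simple t) := by
    rw [hbraid4] at l4 ⊢
    exact (cs.bruhatEdge_mul_simple (by lia)).le
  -- on the remaining four elements, `N` takes values in these elements
  have hup : ∀ x, cs.BruhatLE x m → cs.simple s * cs.simple t = x ∨ 3 ≤ cs.length x →
      N x = cs.simple s * cs.simple t ∨ N x = cs.simple s * cs.simple t * cs.simple s ∨
      N x = cs.simple t * cs.simple s * cs.simple t ∨
      N x = cs.simple s * cs.simple t * cs.simple s * cs.simple t := by
    intro x hx h
    have h' : x ≠ 1 ∧ x ≠ cs.simple s ∧ x ≠ cs.simple t ∧ x ≠ cs.simple t * cs.simple s := by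
      rcases h with rfl | h
      · exact ⟨hst1, hst2, hst3, hcomm⟩
      · obtain ⟨n1, n2, n3, n4, -⟩ := hnot x h
        exact ⟨n1, n2, n3, n4⟩
    obtain ⟨o1, o2, o3, o4⟩ := hout x hx h'.1 h'.2.1 h'.2.2.1 h'.2.2.2
    have := cs.mem_parabolic_pair_of_braid_four (hmem x hx) hbraid4
    tauto
  have hstm : cs.BruhatLE (cs.simple s * cs.simple t) m := by
    by_contra hcon
    refine hne fun x hx => ?_
    rcases cs.mem_parabolic_pair_of_braid_four (hx.mem_parabolic hm) hbraid4 with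
      rfl | rfl | rfl | rfl | rfl | rfl | rfl | rfl
    · simp [rho, h1]
    · simp [rho, h3]
    · simp [rho, h2]
    · exact absurd hx hcon
    · simp [rho, h4]
    · exact absurd (e1.trans hx) hcon
    · exact absurd (e2.trans hx) hcon
    · exact absurd (e1.trans (e3.trans hx)) hcon
  have hNst : N (cs.simple s * cs.simple t) = cs.simple t * cs.simple s * cs.simple t := by
    rcases hup _ hstm (.inl rfl) with h | h | h | h
    · exact absurd h (hself _ hstm)
    -- If `N` pairs `st` with `sts`, then `tst` can only be paired with `stst`, and `N` is `ρ_s`.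
    · exfalso
      have hNsts := hinv _ _ hstm h
      have e5 : cs.BruhatLE (cs.simple t * cs.simple s * cs.simple t) m →
          N (cs.simple t * cs.simple s * cs.simple t) =
            cs.simple s * cs.simple t * cs.simple s * cs.simple t := by
        intro hx
        rcases hup _ hx (.inr l3'.ge) with h' | h' | h' | h'
        · have := hinv _ _ hx h'
          rw [h] at this
          exact absurd this.symm hbraid
        · have := hinv _ _ hx h'
          rw [← hNsts] at this
          rw [this] at l3'
          lia
        · exact absurd h' (hself _ hx)
        · exact h'
      refine hne fun x hx => ?_
      rcases cs.mem_parabolic_pair_of_braid_four (hx.mem_parabolic hm) hbraid4 with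
        rfl | rfl | rfl | rfl | rfl | rfl | rfl | rfl
      · simp [rho, h1]
      · simp [rho, h3]
      · simp [rho, h2]
      · exact h
      · simp [rho, h4]
      · rw [← hNsts]; simp [rho]
      · rw [e5 hx, hbraid4, rho]
      · rw [← hinv _ _ (e4.trans hx) (e5 (e4.trans hx)), rho, hbraid4,
          simple_mul_simple_cancel_right]
    · exact h
    -- `st` and `stst` cannot be matched, since `sts` lies strictly between them.
    · exfalso
      rcases hN.edge _ hstm with h' | h' <;> rw [h] at h'
      · rcases h'.2.2 _ e1 e3 with h'' | h'' <;> rw [h''] at l3 <;> lia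
      · have := h'.1.length_le
        lia
  have htst : cs.BruhatLE (cs.simple t * cs.simple s * cs.simple t) m := hNst ▸ hN.mapsTo _ hstm
  have hNtst := hinv _ _ hstm hNst
  refine ⟨hCst, hbraid, l3', l4, hbraid4, hNst, ?_⟩
  have hml := htst.length_le
  rw [l3'] at hml
  obtain ⟨n1, n2, n3, n4, n5⟩ := hnot m hml
  rcases cs.mem_parabolic_pair_of_braid_four hm hbraid4 with
    h | h | h | h | h | h | h | h
  · exact absurd h n1
  · exact absurd h n2
  · exact absurd h n3
  · exact absurd h n5
  · exact absurd h n4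
  · rw [h] at htst
    exact absurd (htst.eq_of_length_le (by lia)).symm hbraid
  · exact .inl h
  · have hx : cs.BruhatLE (cs.simple s * cs.simple t * cs.simple s) m := h ▸ e3
    have hNsts : N (cs.simple s * cs.simple t * cs.simple s) =
        cs.simple s * cs.simple t * cs.simple s * cs.simple t := by
      rcases hup _ hx (.inr l3.ge) with h' | h' | h' | h'
      · have := hinv _ _ hx h'
        rw [hNst] at this
        exact absurd this hbraid
      · exact absurd h' (hself _ hx)
      · have := hinv _ _ hx h'
        rw [← hNtst] at this
        rw [this] at l3
        lia
      · exact h'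
    have hNm := hinv _ _ hx hNsts
    refine .inr ⟨h, hNsts, fun x hx => ?_⟩
    rcases cs.mem_parabolic_pair_of_braid_four hx hbraid4 with
      rfl | rfl | rfl | rfl | rfl | rfl | rfl | rfl
    · simp [h1, h3]
    · simp [h1, h3]
    · simp [h2, h4]
    · rw [hNsts, hNst, hbraid4]
    · simp [h2, h4]
    · rw [simple_mul_simple_cancel_right, hNst, hNsts, hbraid4, simple_mul_simple_cancel_right]
    · rw [← hbraid4, ← hNm, ← hNtst]
    · rw [hbraid4, simple_mul_simple_cancel_right, ← hNtst, ← hbraid4, ← hNm,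
        simple_mul_simple_cancel_right]

/-! ### The matching of a right system -/

theorem IsParabolicMax.mem {J : Set B} {w x : W} (h : cs.IsParabolicMax J w x) :
    x ∈ cs.parabolic J := h.1.1

/-- The placeholder value 1 has length 0, so nothing of length 1 lies below it. Thus the condition
`t ≤ w₀(s,t)` of a system guarantees that the maximum exists. -/
theorem isParabolicMax_of_simple_le {J : Set B} {w : W} {i : B}
    (h : cs.BruhatLE (cs.simple i) (cs.parabolicMax J w)) :
    cs.IsParabolicMax J w (cs.parabolicMax J w) := by
  by_cases he : ∃ x, cs.IsParabolicMax J w x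
  · rw [parabolicMax, dif_pos he]; exact he.choose_spec
  · rw [parabolicMax, dif_neg he] at h
    have := h.length_le
    rw [length_one, length_simple] at this
    lia

variable (cs)

/-- The middle factor `(u^J)_{s,t} · _{s}(u_J)` on which the matching of a right system acts. -/
noncomputable def midR (J : Set B) (s t : B) (u : W) : W :=
  cs.lowR {s, t} (cs.upR J u) * cs.lowL {s} (cs.lowR J u)

theorem upR_mul_midR_mul_upL (J : Set B) (s t : B) (u : W) :
    cs.upR {s, t} (cs.upR J u) * cs.midR J s t u * cs.upL {s} (cs.lowR J u) = u := by
  rw [midR, mul_assoc, mul_assoc, lowL_mul_upL, ← mul_assoc, upR_mul_lowR, upR_mul_lowR]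

theorem rightSystemMap_eq (J : Set B) (s t : B) (N : W → W) (u : W) :
    cs.rightSystemMap J s t N u =
      cs.upR {s, t} (cs.upR J u) * N (cs.midR J s t u) * cs.upL {s} (cs.lowR J u) := rfl

theorem midR_mem (J : Set B) (s t : B) (u : W) : cs.midR J s t u ∈ cs.parabolic {s, t} :=
  mul_mem (cs.lowR_mem _ _) (cs.parabolic_mono (by simp) (cs.lowL_mem {s} (cs.lowR J u)))

/-- The three successive parabolic factorizations are length-additive; subadditivity of length then
forces equality after regrouping the two inner factors. -/
theorem length_midR (J : Set B) (s t : B) (u : W) :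
    cs.length (cs.midR J s t u) =
      cs.length (cs.lowR {s, t} (cs.upR J u)) + cs.length (cs.lowL {s} (cs.lowR J u)) ∧
    cs.length u = cs.length (cs.upR {s, t} (cs.upR J u)) + cs.length (cs.midR J s t u) +
      cs.length (cs.upL {s} (cs.lowR J u)) := by
  have h1 := cs.length_upR_add_length_lowR J u
  have h2 := cs.length_upR_add_length_lowR {s, t} (cs.upR J u)
  have h3 := cs.length_lowL_add_length_upL {s} (cs.lowR J u)
  have h4 := cs.length_mul_le (cs.lowR {s, t} (cs.upR J u)) (cs.lowL {s} (cs.lowR J u))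
  have h5 := cs.length_mul_le (cs.upR {s, t} (cs.upR J u) * cs.midR J s t u)
    (cs.upL {s} (cs.lowR J u))
  have h6 := cs.length_mul_le (cs.upR {s, t} (cs.upR J u)) (cs.midR J s t u)
  rw [upR_mul_midR_mul_upL] at h5
  rw [← midR] at h4
  lia

theorem midR_le (J : Set B) (s t : B) (u : W) : cs.BruhatLE (cs.midR J s t u) u := by
  have h1 := (cs.length_midR J s t u).2
  have h2 := cs.length_mul_le (cs.upR {s, t} (cs.upR J u) * cs.midR J s t u)
    (cs.upL {s} (cs.lowR J u))
  have h3 := cs.length_mul_le (cs.upR {s, t} (cs.upR J u)) (cs.midR J s t u)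
  have h4 := cs.upR_mul_midR_mul_upL J s t u
  rw [h4] at h2
  have h5 := cs.bruhatLE_mul_right_of_length (x := cs.upR {s, t} (cs.upR J u) * cs.midR J s t u)
    (y := cs.upL {s} (cs.lowR J u)) (by rw [h4]; lia)
  rw [h4] at h5
  exact (cs.bruhatLE_mul_left_of_length (by lia)).trans h5

variable {cs}
variable {w : W} {J : Set B} {s t : B} {N : W → W}

theorem IsRightSystem.isParabolicMax (h : cs.IsRightSystem w J s t N) :
    cs.IsParabolicMax {s, t} w (cs.parabolicMax {s, t} w) :=
  isParabolicMax_of_simple_le h.t_le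

theorem IsRightSystem.midR_le (h : cs.IsRightSystem w J s t N) {u : W} (hu : cs.BruhatLE u w) :
    cs.BruhatLE (cs.midR J s t u) (cs.parabolicMax {s, t} w) :=
  h.isParabolicMax.2 _ (cs.midR_mem J s t u) ((cs.midR_le J s t u).trans hu)

theorem IsRightSystem.map_midR_mem (h : cs.IsRightSystem w J s t N) {u : W}
    (hu : cs.BruhatLE u w) : N (cs.midR J s t u) ∈ cs.parabolic {s, t} :=
  (h.special.mapsTo _ (h.midR_le hu)).mem_parabolic h.isParabolicMax.mem

/-- The hypothesis `H` is restricted to the `u` for which right multiplication by `r` passes through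
the third factor and comes out as `s`. For every other `u` it alters only the third factor, which
`M` leaves alone. -/
theorem IsRightSystem.commuteOn_rho (h : cs.IsRightSystem w J s t N) {M : W → W}
    (hM : ∀ u, cs.BruhatLE u w → M u = cs.rightSystemMap J s t N u) {r : B} (hr : r ∈ J)
    (hd : cs.IsRightDescent w r)
    (H : ∀ u, cs.BruhatLE u w →
      cs.upL {s} (cs.lowR J u) * cs.simple r = cs.simple s * cs.upL {s} (cs.lowR J u) →
      N (cs.midR J s t u * cs.simple s) = N (cs.midR J s t u) * cs.simple s) :
    cs.CommuteOn w M (cs.rho r) := by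
  intro u hu
  have hur : cs.BruhatLE (u * cs.simple r) w := hu.mul_simple_le_of_isRightDescent hd
  have h1 := cs.upR_mul_eq (cs.upR_mem J u)
    (mul_mem (cs.lowR_mem J u) (cs.simple_mem_parabolic hr))
  rw [← mul_assoc, upR_mul_lowR] at h1
  rw [rho, rho, hM _ hur, hM _ hu, rightSystemMap_eq, rightSystemMap_eq, midR, h1.1, h1.2]
  have hx : ∀ j ∈ ({s} : Set B), ¬ cs.IsLeftDescent (cs.upL {s} (cs.lowR J u)) j :=
    cs.not_isLeftDescent_upL {s} (cs.lowR J u)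
  have hc := cs.lowL_mem {s} (cs.lowR J u)
  by_cases hl : cs.IsLeftDescent (cs.upL {s} (cs.lowR J u) * cs.simple r) s
  · have h2 := cs.mul_simple_eq_simple_mul_of_isLeftDescent (hx s rfl) hl
    have h3 := cs.lowL_mul_eq hx (mul_mem hc (cs.simple_mem_parabolic (J := {s}) rfl))
    rw [mul_assoc, ← h2, ← mul_assoc, lowL_mul_upL] at h3
    rw [h3.1, h3.2, ← mul_assoc, ← midR, H u hu h2, mul_assoc _ _ (cs.simple r), h2]
    simp only [mul_assoc]
  · have h3 := cs.lowL_mul_eq (J := {s}) (x := cs.upL {s} (cs.lowR J u) * cs.simple r)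
      (by rintro j rfl; exact hl) hc
    rw [← mul_assoc, lowL_mul_upL] at h3
    rw [h3.1, h3.2, ← midR, mul_assoc _ _ (cs.simple r)]

/-- The case in which `^{s}(w_J)` is not trivial. -/
theorem IsRightSystem.exists_of_upL_ne_one (hC : C.IsDoublyLaced)
    (h : cs.IsRightSystem w J s t N) {M : W → W}
    (hM : ∀ u, cs.BruhatLE u w → M u = cs.rightSystemMap J s t N u)
    (hd : cs.upL {s} (cs.lowR J w) ≠ 1) :
    ∃ ρ : W → W, cs.IsRightMulMatching w ρ ∧ cs.CommuteOn w M ρ ∧ ρ w ≠ M w := by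
  set d := cs.upL {s} (cs.lowR J w) with hdd
  have hdJ : d ∈ cs.parabolic J := by
    have h1 := cs.lowL_mul_upL {s} (cs.lowR J w)
    rw [← eq_inv_mul_iff_mul_eq] at h1
    rw [hdd, h1]
    exact mul_mem (inv_mem (cs.parabolic_mono (by simpa using h.s_mem) (cs.lowL_mem _ _)))
      (cs.lowR_mem _ _)
  obtain ⟨r, hr, hrd⟩ : ∃ r ∈ J, cs.IsRightDescent d r := by
    by_contra! hcon
    exact hd (cs.eq_one_of_mem hcon hdJ)
  have hw : cs.upR {s, t} (cs.upR J w) * cs.midR J s t w * d = w := cs.upR_mul_midR_mul_upL J s t w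
  have hwr : cs.IsRightDescent w r := by
    have h1 := (cs.length_midR J s t w).2
    have h2 := cs.length_mul_le (cs.upR {s, t} (cs.upR J w)) (cs.midR J s t w)
    have h3 := cs.length_mul_le (cs.upR {s, t} (cs.upR J w) * cs.midR J s t w) (d * cs.simple r)
    rw [← mul_assoc, hw] at h3
    rw [IsRightDescent] at hrd ⊢
    lia
  refine ⟨cs.rho r, cs.isRightMulMatching_rho hwr, h.commuteOn_rho hM hr hwr ?_, ?_⟩
  · intro u hu hx
    -- (R5) is applied to `w` itself when `r = s`, since then `s ≤ d`. Otherwise it is applied to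
    -- `u`: `s` lies below `s * x = x * r`, hence below `x`, where `x` is the third factor of `u`.
    by_cases hrs : r = s
    · exact h.commute_rho w (.refl _) (by have := hrd.simple_le; rwa [hrs] at this) _
        ((cs.midR_le J s t u).trans hu) (h.midR_le hu)
    · refine h.commute_rho u hu ?_ _ (cs.midR_le J s t u) (h.midR_le hu)
      have h1 : cs.BruhatLE (cs.simple s) (cs.upL {s} (cs.lowR J u) * cs.simple r) := by
        rw [hx]
        refine cs.bruhatLE_mul_right_of_length ?_
        rw [cs.not_isLeftDescent_iff.1 (cs.not_isLeftDescent_upL {s} (cs.lowR J u) s rfl),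
          length_simple, add_comm]
      exact (cs.simple_le_of_le_mul_simple h1).resolve_right
        fun he => hrs (cs.simple_injective hC he.symm)
  · rw [hM w (.refl _), rightSystemMap_eq, ← hdd, rho]
    intro he
    have h1 : d * cs.simple r * d⁻¹ = (cs.midR J s t w)⁻¹ * N (cs.midR J s t w) := by
      nth_rw 1 [← hw] at he
      rw [mul_assoc _ d, mul_assoc, mul_assoc, mul_right_inj, ← eq_inv_mul_iff_mul_eq,
        ← mul_assoc] at he
      rw [he, mul_inv_cancel_right]
    have h2 : d * cs.simple r * d⁻¹ ∈ cs.parabolic (J ∩ {s, t}) := by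
      refine cs.mem_parabolic_inter hC (mul_mem (mul_mem hdJ (cs.simple_mem_parabolic hr))
        (inv_mem hdJ)) ?_
      rw [h1]
      exact mul_mem (inv_mem (cs.midR_mem J s t w)) (h.map_midR_mem (.refl _))
    have h3 : d * cs.simple r * d⁻¹ ∈ cs.parabolic {s} := by
      refine cs.parabolic_mono ?_ h2
      rintro j ⟨hj, rfl | rfl⟩
      · rfl
      · exact absurd hj h.t_notMem
    rcases cs.mem_parabolic_singleton h3 with h4 | h4
    · rw [mul_inv_eq_one, mul_eq_left] at h4
      exact cs.simple_ne_one r h4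
    -- Here `d * r = s * d`, but the left side is shorter than `d` and the right side is longer.
    · rw [mul_inv_eq_iff_eq_mul] at h4
      have h5 := cs.not_isLeftDescent_iff.1 (cs.not_isLeftDescent_upL {s} (cs.lowR J w) s rfl)
      rw [IsRightDescent, h4] at hrd
      lia

/-- If `N = ρ_s` and `^{s}(w_J)` is trivial, then the matching of the right system is `ρ_s`. -/
theorem IsRightSystem.rightSystemMap_eq_rho (h : cs.IsRightSystem w J s t N)
    (hd : cs.upL {s} (cs.lowR J w) = 1)
    (hN : ∀ x, cs.BruhatLE x (cs.parabolicMax {s, t} w) → N x = cs.rho s x)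
    {u : W} (hu : cs.BruhatLE u w) : cs.rightSystemMap J s t N u = cs.rho s u := by
  have hwJ : w = cs.upR J w ∨ w = cs.upR J w * cs.simple s := by
    have h1 := cs.upR_mul_lowR J w
    have h2 := cs.lowL_mul_upL {s} (cs.lowR J w)
    rw [hd, mul_one] at h2
    rw [← h2] at h1
    rcases cs.mem_parabolic_singleton (cs.lowL_mem {s} (cs.lowR J w)) with h3 | h3 <;>
      rw [h3] at h1
    · rw [mul_one] at h1; exact .inl h1.symm
    · exact .inr h1.symm
  -- As `w` is `w^J` or `w^J * s`, condition (R3) extends from `w^J` to all of `w`, so `s` commutes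
  -- with `u_J` for every `u ≤ w`.
  have hr : ∀ r ∈ J, cs.BruhatLE (cs.simple r) w →
      cs.simple r * cs.simple s = cs.simple s * cs.simple r := by
    intro r hr hle
    rcases hwJ with h1 | h1
    · exact h.commute_s r hr (h1 ▸ hle)
    · rw [h1] at hle
      rcases cs.simple_le_of_le_mul_simple hle with h2 | h2
      · exact h.commute_s r hr h2
      · rw [h2]
  have huJ : cs.lowR J u * cs.simple s = cs.simple s * cs.lowR J u := by
    have h1 : cs.BruhatLE (cs.lowR J u) w := by
      refine BruhatLE.trans ?_ hu
      have := cs.bruhatLE_mul_left_of_length (x := cs.upR J u) (y := cs.lowR J u)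
        (by rw [upR_mul_lowR]; exact cs.length_upR_add_length_lowR J u)
      rwa [upR_mul_lowR] at this
    have h2 := cs.lowR_mem J u
    generalize cs.lowR J u = y at h1 h2
    obtain ⟨ω, hω, rfl, hJ⟩ := cs.exists_wordProd_of_mem_parabolic h2
    have h3 : ∀ i ∈ ω, cs.simple i * cs.simple s = cs.simple s * cs.simple i := fun i hi =>
      hr i (hJ i hi) ((hω.simple_le hi).trans h1)
    clear h1 h2 hω hJ
    induction ω with
    | nil => simp
    | cons i ω ih =>
      rw [wordProd_cons, mul_assoc, ih fun j hj => h3 j (List.mem_cons_of_mem _ hj), ← mul_assoc,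
        h3 i (by simp), mul_assoc]
  have hx : cs.upL {s} (cs.lowR J u) * cs.simple s = cs.simple s * cs.upL {s} (cs.lowR J u) := by
    have h2 := cs.lowL_mul_upL {s} (cs.lowR J u)
    rcases cs.mem_parabolic_singleton (cs.lowL_mem {s} (cs.lowR J u)) with h3 | h3 <;>
      rw [h3] at h2
    · rw [one_mul] at h2; rw [h2, huJ]
    · rw [← h2, mul_assoc, mul_right_inj] at huJ
      exact huJ
  rw [rightSystemMap_eq, hN _ (h.midR_le hu), rho, rho, ← mul_assoc, mul_assoc, ← hx, ← mul_assoc,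
    upR_mul_midR_mul_upL]

end CoxeterSystem

/-! ### The dichotomy for right systems -/

namespace CoxeterSystem

variable {B W : Type*} [Group W] {C : CoxeterMatrix B} {cs : CoxeterSystem C W}
variable {w : W} {J : Set B} {s t : B} {N M : W → W}

/-- By (R4), `s` below `(w^J)^{s,t}` would make `N` equal to `ρ_s` or commute with `λ_s`; the
latter, evaluated at `t`, gives `N(st) = sts` instead of `tst`. -/
theorem IsRightSystem.not_simple_le (h : cs.IsRightSystem w J s t N)
    (hbraid : cs.simple s * cs.simple t * cs.simple s ≠ cs.simple t * cs.simple s * cs.simple t)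
    (hNst : N (cs.simple s * cs.simple t) = cs.simple t * cs.simple s * cs.simple t)
    (hne : ¬ ∀ x, cs.BruhatLE x (cs.parabolicMax {s, t} w) → N x = cs.rho s x) :
    ¬ cs.BruhatLE (cs.simple s) (cs.upR {s, t} (cs.upR J w)) := by
  intro hs
  by_cases ht : cs.BruhatLE (cs.simple t) (cs.upR {s, t} (cs.upR J w))
  · exact hne (h.both_le hs ht)
  · have h1 := h.only_s_le hs ht _ h.t_le
    rw [lam, lam, hNst, h.map_t, ← mul_assoc] at h1
    exact hbraid h1.symm

/-- If `^{s}(w_J)` is trivial, then `w = a z` with `a` in `W^{s,t}` and `z` in `W_{s,t}`. If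
moreover `s` does not lie below `a`, then `z` or `tz` lies above `w₀(s,t)`. -/
theorem IsRightSystem.le_midR_or (h : cs.IsRightSystem w J s t N) (hC : C.IsDoublyLaced)
    (hd : cs.upL {s} (cs.lowR J w) = 1)
    (hs : ¬ cs.BruhatLE (cs.simple s) (cs.upR {s, t} (cs.upR J w))) :
    ∃ z, cs.BruhatLE z (cs.midR J s t w) ∧
      (cs.parabolicMax {s, t} w = z ∨ cs.parabolicMax {s, t} w = cs.simple t * z) := by
  have hw := cs.upR_mul_midR_mul_upL J s t w
  rw [hd, mul_one] at hw
  have hle := h.isParabolicMax.1.2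
  nth_rw 2 [← hw] at hle
  -- The factor `z₁` lies below `a` and in `W_{s,t}`; as `s` is not below `a`, it is 1 or `t`.
  obtain ⟨z₁, z₂, h1, h2, h3⟩ := cs.exists_mul_of_le_mul hle
  refine ⟨z₂, h2, ?_⟩
  have hz₁ : z₁ ∈ cs.parabolic {s, t} := by
    rw [← mul_inv_eq_iff_eq_mul.2 h3]
    exact mul_mem h.isParabolicMax.mem (inv_mem (h2.mem_parabolic (cs.midR_mem J s t w)))
  have hz₁' : z₁ ∈ cs.parabolic {t} := by
    refine cs.mem_parabolic_of_simple_le fun i hi => ?_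
    rcases cs.mem_of_simple_mem_parabolic hC (hi.mem_parabolic hz₁) with rfl | hi'
    · exact absurd (hi.trans h1) hs
    · exact hi'
  rcases cs.mem_parabolic_singleton hz₁' with rfl | rfl
  · exact .inl (by rw [h3, one_mul])
  · exact .inr h3

theorem IsRightSystem.exists_isRightMulMatching (h : cs.IsRightSystem w J s t N)
    (hC : C.IsDoublyLaced) (hMw : cs.IsMatching w M)
    (hM : ∀ u, cs.BruhatLE u w → M u = cs.rightSystemMap J s t N u)
    (hR : ¬ cs.IsRightMulMatching w M) :
    (∃ ρ : W → W, cs.IsRightMulMatching w ρ ∧ cs.CommuteOn w M ρ ∧ ρ w ≠ M w) ∨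
      (C s t = 4 ∧
        cs.parabolicMax {s, t} w = cs.simple t * cs.simple s * cs.simple t ∧
        cs.lowR J w = 1 ∧
        w = cs.upR {s, t} (cs.upR J w) * (cs.simple t * cs.simple s * cs.simple t)) := by
  by_cases hd : cs.upL {s} (cs.lowR J w) = 1
  swap
  · exact .inl (h.exists_of_upL_ne_one hC hM hd)
  have hMle := (hMw.mapsTo w (.refl _)).length_le
  have hne : ¬ ∀ x, cs.BruhatLE x (cs.parabolicMax {s, t} w) → N x = cs.rho s x := by
    intro hN
    have hrho : ∀ u, cs.BruhatLE u w → M u = cs.rho s u := fun u hu => by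
      rw [hM u hu, h.rightSystemMap_eq_rho hd hN hu]
    refine hR ⟨hMw, s, ?_, hrho⟩
    rw [hrho w (.refl _)] at hMle
    exact lt_of_le_of_ne hMle (cs.length_mul_simple_ne w s)
  have hst : s ≠ t := fun e => h.t_notMem (e ▸ h.s_mem)
  obtain ⟨hCst, hbraid, l3, l4, hbraid4, hNst, hcases⟩ := h.special.toIsMatching.dihedral hC hst
    h.isParabolicMax.mem h.map_one h.t_le h.map_t hne
  have hw := cs.upR_mul_midR_mul_upL J s t w
  rw [hd, mul_one] at hw
  have hMw' := hM w (.refl _)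
  rw [rightSystemMap_eq, hd, mul_one] at hMw'
  have ha := cs.upR_mem {s, t} (cs.upR J w)
  have hz := cs.midR_mem J s t w
  have hzle := h.midR_le (.refl w)
  -- Since `w = a * z` and `M w = a * N z` are both length-additive, `M w ≤ w` says that `N` does
  -- not lengthen `z`.
  have hNz : cs.length (N (cs.midR J s t w)) ≤ cs.length (cs.midR J s t w) := by
    have h1 := cs.length_mul_of_mem ha hz
    rw [hMw', cs.length_mul_of_mem ha (h.map_midR_mem (.refl w))] at hMle
    rw [hw] at h1
    lia
  have hzm : cs.midR J s t w = cs.parabolicMax {s, t} w := by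
    obtain ⟨z, h1, h2 | h2⟩ := h.le_midR_or hC hd (h.not_simple_le hbraid hNst hne)
    · exact hzle.antisymm (h2 ▸ h1)
    refine hzle.eq_of_length_le ?_
    -- Otherwise `w₀(s,t) = t * z`, so `z` is `st` or `sts`, and `N` sends it up to `tst` or `stst`
    -- respectively.
    by_contra! hlt
    have h3 := cs.length_simple_mul z t
    rw [← h2] at h3
    have h4 : z = cs.midR J s t w := h1.eq_of_length_le (by have := h1.length_le; lia)
    rw [h4] at h2
    rcases hcases with h5 | ⟨h5, h6, -⟩
    · have h7 : cs.midR J s t w = cs.simple s * cs.simple t := by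
        rw [h5, mul_assoc, mul_right_inj] at h2; exact h2.symm
      rw [h7, hNst, ← h5, ← h7] at hNz
      lia
    · have h7 : cs.midR J s t w = cs.simple s * cs.simple t * cs.simple s := by
        rw [h5, hbraid4, mul_assoc, mul_assoc, mul_right_inj, ← mul_assoc] at h2; exact h2.symm
      rw [h7, h6, ← h5, ← h7] at hNz
      lia
  rcases hcases with hm | ⟨hm, hN1, hN2⟩
  · refine .inr ⟨hCst, hm, ?_, ?_⟩
    · have h1 := cs.lowL_mul_upL {s} (cs.lowR J w)
      rw [hd, mul_one] at h1
      rcases cs.mem_parabolic_singleton (cs.lowL_mem {s} (cs.lowR J w)) with h2 | h2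
      · rw [← h1, h2]
      -- If `w_J = s`, length-additivity would make `s` a right descent of `z = tst`, whereas `tst *
      -- s` has length 4.
      · exfalso
        have h3 := (cs.length_midR J s t w).1
        have h4 : cs.midR J s t w * cs.simple s = cs.lowR {s, t} (cs.upR J w) := by
          rw [midR, h2, simple_mul_simple_cancel_right]
        rw [hzm, hm, ← hbraid4] at h4
        rw [hzm, hm, ← h4, h2, length_simple] at h3
        lia
    · rw [hm] at hzm
      rw [← hzm, hw]
  · left
    rw [hm] at hzm
    have hzs : cs.midR J s t w * cs.simple s = cs.simple t * cs.simple s * cs.simple t := by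
      rw [hzm, hbraid4, simple_mul_simple_cancel_right]
    have hds : cs.IsRightDescent w s := by
      have h1 := cs.length_mul_of_mem ha hz
      have h2 := cs.length_mul_of_mem ha (mul_mem hz (cs.simple_mem_parabolic (i := s) (by simp)))
      rw [← mul_assoc, hw, hzs] at h2
      rw [hw, hzm] at h1
      rw [IsRightDescent]
      lia
    -- Here `z = stst`, and `ρ_s` and `N` send it to the distinct elements `tst` and `sts`.
    refine ⟨cs.rho s, cs.isRightMulMatching_rho hds,
      h.commuteOn_rho hM h.s_mem hds fun u _ _ => hN2 _ (cs.midR_mem J s t u), ?_⟩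
    have hNm : N (cs.midR J s t w) = cs.simple s * cs.simple t * cs.simple s := by
      rw [hzm, ← hN1]
      refine h.special.involutive _ ?_
      rw [hm]
      have h1 := cs.length_wordProd_le [s, t, s]
      simp only [wordProd_cons, wordProd_nil, mul_one, ← mul_assoc, List.length_cons,
        List.length_nil] at h1
      exact (cs.bruhatEdge_mul_simple (by lia)).le
    rw [hMw', rho, hNm]
    nth_rw 1 [← hw]
    intro e
    rw [mul_assoc, mul_right_inj, hzs] at e
    exact hbraid e.symm

/-! ### Inversion exchanges left and right systems -/

/-- The conjugate of a map by inversion. -/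
def invConj (M : W → W) (u : W) : W := (M u⁻¹)⁻¹

theorem BruhatCovBy.inv {x y : W} (h : cs.BruhatCovBy x y) : cs.BruhatCovBy x⁻¹ y⁻¹ := by
  refine ⟨h.1.inv, fun e => h.2.1 (inv_injective e), fun z h1 h2 => ?_⟩
  have := h.2.2 z⁻¹ (by simpa using h1.inv) (by simpa using h2.inv)
  simpa [inv_eq_iff_eq_inv] using this

theorem bruhatLE_inv_left {u v : W} : cs.BruhatLE u⁻¹ v ↔ cs.BruhatLE u v⁻¹ := by
  rw [← bruhatLE_inv_iff, inv_inv]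

theorem IsMatching.invConj (h : cs.IsMatching w M) : cs.IsMatching w⁻¹ (invConj M) where
  mapsTo u hu := (h.mapsTo u⁻¹ (bruhatLE_inv_left.2 hu)).inv
  involutive u hu := by
    simp [CoxeterSystem.invConj, h.involutive u⁻¹ (bruhatLE_inv_left.2 hu)]
  edge u hu := by
    have := h.edge u⁻¹ (bruhatLE_inv_left.2 hu)
    exact this.imp (fun h => by have h' := h.inv; rwa [inv_inv] at h')
      (fun h => by have h' := h.inv; rwa [inv_inv] at h')

theorem IsSpecialMatching.invConj (h : cs.IsSpecialMatching w M) :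
    cs.IsSpecialMatching w⁻¹ (invConj M) where
  toIsMatching := h.toIsMatching.invConj
  special u v hu hv huv hne := (h.special u⁻¹ v⁻¹ (bruhatLE_inv_left.2 hu)
    (bruhatLE_inv_left.2 hv) huv.inv fun e => hne (by simp [CoxeterSystem.invConj, e])).inv

theorem IsParabolicMax.inv {K : Set B} {x : W} (h : cs.IsParabolicMax K w x) :
    cs.IsParabolicMax K w⁻¹ x⁻¹ :=
  ⟨⟨inv_mem h.1.1, h.1.2.inv⟩, fun y hy hyw => bruhatLE_inv_left.1
    (h.2 y⁻¹ (inv_mem hy) (bruhatLE_inv_left.2 hyw))⟩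

theorem IsParabolicMax.eq_parabolicMax {K : Set B} {x : W} (h : cs.IsParabolicMax K w x) :
    cs.parabolicMax K w = x := by
  have he : ∃ x, cs.IsParabolicMax K w x := ⟨x, h⟩
  rw [parabolicMax, dif_pos he]
  exact (h.2 _ he.choose_spec.1.1 he.choose_spec.1.2).antisymm (he.choose_spec.2 _ h.1.1 h.1.2)

/-- Inversion preserves `W_{s,t}` and Bruhat order, and a greatest element is unique, so the choice
in `parabolicMax` does not matter. -/
theorem IsLeftSystem.parabolicMax_inv (h : cs.IsLeftSystem w J s t N) :
    cs.parabolicMax {s, t} w⁻¹ = (cs.parabolicMax {s, t} w)⁻¹ :=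
  (isParabolicMax_of_simple_le h.t_le).inv.eq_parabolicMax

variable (cs) in
theorem rightSystemMap_invConj (J : Set B) (s t : B) (N : W → W) (u : W) :
    cs.rightSystemMap J s t (invConj N) u⁻¹ = (cs.leftSystemMap J s t N u)⁻¹ := by
  simp [rightSystemMap, leftSystemMap, invConj, upL, lowL, mul_assoc]

theorem simple_le_inv {i : B} {x : W} :
    cs.BruhatLE (cs.simple i) x⁻¹ ↔ cs.BruhatLE (cs.simple i) x := by
  rw [← bruhatLE_inv_left, inv_simple]

theorem upR_inv (J : Set B) (w : W) : cs.upR J w⁻¹ = (cs.upL J w)⁻¹ := by rw [upL, inv_inv]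

theorem lowR_inv (J : Set B) (w : W) : cs.lowR J w⁻¹ = (cs.lowL J w)⁻¹ := by rw [lowL, inv_inv]

theorem upL_inv (J : Set B) (w : W) : cs.upL J w⁻¹ = (cs.upR J w)⁻¹ := by rw [upL, inv_inv]

theorem lam_inv (i : B) (u : W) : cs.lam i u⁻¹ = (cs.rho i u)⁻¹ := by simp [lam, rho]

theorem rho_inv (i : B) (u : W) : cs.rho i u⁻¹ = (cs.lam i u)⁻¹ := by simp [lam, rho]

theorem IsLeftSystem.inv (h : cs.IsLeftSystem w J s t N) :
    cs.IsRightSystem w⁻¹ J s t (invConj N) where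
  s_mem := h.s_mem
  t_notMem := h.t_notMem
  special := by rw [h.parabolicMax_inv]; exact h.special.invConj
  map_one := by simp [invConj, h.map_one]
  t_le := by rw [h.parabolicMax_inv, simple_le_inv]; exact h.t_le
  map_t := by simp [invConj, h.map_t]
  map_le u hu := by
    have := (h.map_le u⁻¹ (bruhatLE_inv_left.2 hu)).inv
    rwa [← rightSystemMap_invConj, inv_inv] at this
  commute_s r hr hle := h.commute_s r hr (by rwa [upR_inv, simple_le_inv] at hle)
  both_le hs ht x hx := by
    rw [upR_inv, upR_inv, simple_le_inv] at hs ht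
    rw [h.parabolicMax_inv] at hx
    rw [invConj, h.both_le hs ht _ (bruhatLE_inv_left.2 hx), lam_inv, inv_inv]
  only_s_le hs ht x hx := by
    rw [upR_inv, upR_inv, simple_le_inv] at hs ht
    rw [h.parabolicMax_inv] at hx
    rw [invConj, invConj, lam_inv, inv_inj, ← rho_inv, h.only_s_le hs ht _ (bruhatLE_inv_left.2 hx)]
  only_t_le hs ht x hx := by
    rw [upR_inv, upR_inv, simple_le_inv] at hs ht
    rw [h.parabolicMax_inv] at hx
    rw [invConj, invConj, lam_inv, inv_inj, ← rho_inv, h.only_t_le hs ht _ (bruhatLE_inv_left.2 hx)]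
  commute_rho v hv hle x hxv hx := by
    rw [h.parabolicMax_inv] at hx
    rw [← inv_inv v, lowR_inv, upL_inv, simple_le_inv] at hle
    rw [invConj, invConj, rho_inv, inv_inj, ← lam_inv, h.commute_lam v⁻¹ (bruhatLE_inv_left.2 hv) hle
      _ hxv.inv (bruhatLE_inv_left.2 hx)]

theorem invConj_invConj (M : W → W) : invConj (invConj M) = M := by
  funext u
  simp [invConj]

theorem IsRightMulMatching.inv (h : cs.IsRightMulMatching w M) :
    cs.IsLeftMulMatching w⁻¹ (invConj M) := by
  obtain ⟨h1, i, h2, h3⟩ := h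
  refine ⟨h1.invConj, i, cs.isLeftDescent_inv_iff.2 h2, fun u hu => ?_⟩
  rw [invConj, h3 _ (bruhatLE_inv_left.2 hu), rho_inv, inv_inv]

theorem IsLeftMulMatching.inv (h : cs.IsLeftMulMatching w M) :
    cs.IsRightMulMatching w⁻¹ (invConj M) := by
  obtain ⟨h1, i, h2, h3⟩ := h
  refine ⟨h1.invConj, i, cs.isRightDescent_inv_iff.2 h2, fun u hu => ?_⟩
  rw [invConj, h3 _ (bruhatLE_inv_left.2 hu), lam_inv, inv_inv]

theorem IsLeftSystem.exists_isLeftMulMatching (h : cs.IsLeftSystem w J s t N)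
    (hC : C.IsDoublyLaced) (hMw : cs.IsMatching w M)
    (hM : ∀ u, cs.BruhatLE u w → M u = cs.leftSystemMap J s t N u)
    (hL : ¬ cs.IsLeftMulMatching w M) :
    (∃ l : W → W, cs.IsLeftMulMatching w l ∧ cs.CommuteOn w M l ∧ l w ≠ M w) ∨
      (C s t = 4 ∧
        cs.parabolicMax {s, t} w = cs.simple t * cs.simple s * cs.simple t ∧
        cs.lowL J w = 1 ∧
        w = (cs.simple t * cs.simple s * cs.simple t) * cs.upL {s, t} (cs.upL J w)) := by
  have hM' : ∀ u, cs.BruhatLE u w⁻¹ → invConj M u = cs.rightSystemMap J s t (invConj N) u :=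
    fun u hu => by
      rw [invConj, hM _ (bruhatLE_inv_left.2 hu), ← rightSystemMap_invConj, inv_inv]
  have hR : ¬ cs.IsRightMulMatching w⁻¹ (invConj M) := fun hR => hL <| by
    have := hR.inv
    rwa [inv_inv, invConj_invConj] at this
  rcases h.inv.exists_isRightMulMatching hC hMw.invConj hM' hR with
    ⟨ρ, h1, h2, h3⟩ | ⟨h1, h2, h3, h4⟩
  · refine .inl ⟨invConj ρ, by simpa using h1.inv, fun u hu => ?_, fun e => h3 ?_⟩
    · have := h2 u⁻¹ hu.inv
      rw [invConj, invConj, inv_inv, inv_eq_iff_eq_inv] at this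
      exact this
    · rw [invConj, inv_inv, ← e, invConj, inv_inv]
  · refine .inr ⟨h1, ?_, ?_, ?_⟩
    -- The exceptional case is symmetric because `tst` is its own inverse.
    · rw [h.parabolicMax_inv, inv_eq_iff_eq_inv] at h2
      rw [h2]; simp [mul_assoc]
    · rwa [lowR_inv, inv_eq_one] at h3
    · rw [inv_eq_iff_eq_inv, upR_inv, upR_inv] at h4
      nth_rw 1 [h4]
      simp [mul_assoc]

end CoxeterSystem

theorem mainTheorem7 {B W : Type*} [Group W] {C : CoxeterMatrix B} (cs : CoxeterSystem C W)
    (hC : C.IsDoublyLaced) (w : W) (M : W → W) (hM : cs.IsSpecialMatching w M)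
    (J : Set B) (s t : B) (N : W → W) :
    (cs.IsRightSystem w J s t N →
      (∀ u, cs.BruhatLE u w → M u = cs.rightSystemMap J s t N u) →
      ¬ cs.IsRightMulMatching w M →
      (∃ ρ : W → W, cs.IsRightMulMatching w ρ ∧ cs.CommuteOn w M ρ ∧ ρ w ≠ M w) ∨
        (C s t = 4 ∧
          cs.parabolicMax {s, t} w = cs.simple t * cs.simple s * cs.simple t ∧
          cs.lowR J w = 1 ∧
          w = cs.upR {s, t} (cs.upR J w) * (cs.simple t * cs.simple s * cs.simple t))) ∧
    (cs.IsLeftSystem w J s t N →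
      (∀ u, cs.BruhatLE u w → M u = cs.leftSystemMap J s t N u) →
      ¬ cs.IsLeftMulMatching w M →
      (∃ l : W → W, cs.IsLeftMulMatching w l ∧ cs.CommuteOn w M l ∧ l w ≠ M w) ∨
        (C s t = 4 ∧
          cs.parabolicMax {s, t} w = cs.simple t * cs.simple s * cs.simple t ∧
          cs.lowL J w = 1 ∧
          w = (cs.simple t * cs.simple s * cs.simple t) * cs.upL {s, t} (cs.upL J w))) := by
  exact ⟨fun h h' h'' => h.exists_isRightMulMatching hC hM.toIsMatching h' h'',
    fun h h' h'' => h.exists_isLeftMulMatching hC hM.toIsMatching h' h''⟩
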